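/- **Setting.** There are $N\ge 1$ coalitions; coalition $i$ has $n_i\ge 1$ agents $ij$ ($j=1,\dots,n_i$), and $n_{\rm sum}=\sum_i n_i\ge 2$. Agent $ij$ has a state $x_{ij}\in\mathbb R$ and a cost $f_{ij}:\mathbb R^{n_{\rm sum}}\to\mathbb R$; put $f_i=\sum_j f_{ij}$ and $\boldsymbol x_i=(x_{i1},\dots,x_{in_i})^T$. A Nash equilibrium (NE) is a vector $\boldsymbol x^*$ whose blocks are all of the form $\boldsymbol x_i^*=\theta_i\mathbf 1_{n_i}$ and such that, for each $i$, $f_i(\boldsymbol x^*)\le f_i(\theta\mathbf 1_{n_i},\boldsymbol x^*_{-i})$ for all $\theta\in\mathbb R$. Let $g_i(y)=f_i(y_1\mathbf 1_{n_1},\dots,y_N\mathbf 1_{n_N})$ and $\mathcal Q(y)=(\partial g_i/\partial y_i(y))_{i=1}^N$ for $y\in\mathbb R^N$. The agents communicate over a directed graph $\mathcal G$; $a_{ij}^{pq}=1$ if $pq\ne ij$ and there is an edge from $pq$ to $ij$, and $a_{ij}^{pq}=0$ otherwise; $\mathcal N_{ij}$ is the set of in-neighbours of $ij$; $d_{ij}=\sum_{pq}a_{ij}^{pq}$;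 $\mathcal L=\mathrm{diag}(d_{ij})-(a_{ij}^{pq})$; $\mathcal G_i$ is the subgraph induced on coalition $i$. **Assumptions.** $\mathcal G$ and all $\mathcal G_i$ are strongly connected. Each $f_{ij}$ is convex and $C^2$, and $\|\nabla f_{ij}(a)-\nabla f_{ij}(b)\|\le l_{ij}\|a-b\|$ for all $a,b$. There is $l>0$ with $(a-b)^T(\mathcal Q(a)-\mathcal Q(b))\ge l\|a-b\|^2$ for all $a,b\in\mathbb R^N$. **Algorithm.** Let $R_i=[r_{ij}^{im}]_{j,m}$ have rows summing to $1$, with $r_{ij}^{im}>0$ if $m=j$ or $im$ is an in-neighbour of $ij$, and $r_{ij}^{im}=0$ otherwise; let $C_i=[c_{ij}^{im}]_{j,m}$ have columns summing to $1$, with $c_{ij}^{im}>0$ if $m=j$ or $im$ is an in-neighbour of $ij$, and $c_{ij}^{im}=0$ otherwise. With step size $\alpha>0$, for $k\ge 0$, $$x_{ij}(k+1)=\sum_{m=1}^{n_i} r_{ij}^{im}x_{im}(k)-\frac{\alpha}{n_i}\sum_{m=1}^{n_i}\psi_{ij}^{im}(k),$$ $$\psi_{ij}^{il}(k+1)=\sum_{m=1}^{n_i}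 c_{ij}^{im}\psi_{im}^{il}(k)+\frac{\partial f_{ij}}{\partial x_{il}}(\boldsymbol\xi_{ij}(k+1))-\frac{\partial f_{ij}}{\partial x_{il}}(\boldsymbol\xi_{ij}(k)),$$ $$\xi_{ij}^{pq}(k+1)=\xi_{ij}^{pq}(k)-\frac{1}{d_{ij}+a_{ij}^{pq}}\Big(\sum_{rs\in\mathcal N_{ij}}(\xi_{ij}^{pq}(k)-\xi_{rs}^{pq}(k))+a_{ij}^{pq}(\xi_{ij}^{pq}(k)-x_{pq}(k))\Big),$$ where $\boldsymbol x(0)\in\mathbb R^{n_{\rm sum}}$ and $\boldsymbol\xi_{ij}(0)\in\mathbb R^{n_{\rm sum}}$ are arbitrary and $\psi_{ij}^{il}(0)=\frac{\partial f_{ij}}{\partial x_{il}}(\boldsymbol\xi_{ij}(0))$. **Constants.** $\|\cdot\|$ is the Euclidean norm of vectors and the spectral norm of matrices. Let $u_i^TR_i=u_i^T$ and $C_iv_i=v_i$ with $u_i^T\mathbf 1=\mathbf 1^Tv_i=n_i$; $\bar R_i=R_i-\frac{\mathbf 1u_i^T}{n_i}$, $\bar C_i=C_i-\frac{v_i\mathbf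 1^T}{n_i}$, $\bar I_{u_i}=I-\frac{\mathbf 1u_i^T}{n_i}$, $\bar I_{v_i}=I-\frac{v_i\mathbf 1^T}{n_i}$. Let $\Gamma$ and $A_d$ be the diagonal matrices of size $n_{\rm sum}^2$ with entries $1/(d_{ij}+a_{ij}^{pq})$ and $a_{ij}^{pq}$ at position $(ij,pq)$, $B=\Gamma(\mathcal L\otimes I_{n_{\rm sum}}+A_d)$ and $\mathcal M=I-B$. Let $W_{c_i},W_{R_i},W_{\mathcal M}$ be symmetric positive definite with $\bar C_i^TW_{c_i}\bar C_i-W_{c_i}=-I$, $\bar R_i^TW_{R_i}\bar R_i-W_{R_i}=-I$, $\mathcal M^TW_{\mathcal M}\mathcal M-W_{\mathcal M}=-I$. Put $\kappa=4\|\mathcal M^TW_{\mathcal M}\|^2+2\|W_{\mathcal M}\|$ and $$\beta_{\psi\xi}=2\max_{i,j}\{(2\|\bar C_i^TW_{c_i}\bar I_{v_i}\|^2+\|\bar I_{v_i}^TW_{c_i}\bar I_{v_i}\|)l_{ij}^2\}\|B\|^2,\quad \beta_{\psi x}=n_{\rm sum}\beta_{\psi\xi},\quad \beta_{\xi x}=n_{\rm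 sum}\kappa\|B\|^2,$$ $$\beta_{\bar x\psi}=\tfrac2l\max_i\frac{n_i^3\|u_i\|^2}{(u_i^Tv_i)^2},\quad \beta_{\bar x\xi}=\tfrac2l\max_i\Big\{n_i\sum_j l_{ij}^2\Big\},\quad b_{0i}=n_i+\Big(\tfrac1{n_i}+\max_p n_p\Big)\|v_i\|^2\sum_j l_{ij}^2,$$ $$b_{1i}=\frac{\|u_i\|^2}{n_iu_i^Tv_i}b_{0i},\quad b_{2i}=n_{\rm sum}\kappa\Big\|\frac{\mathbf 1u_i^T}{n_i^2}\Big\|^2b_{0i},\quad b_{3i}=\frac1{n_i^2}(2\|\bar R_i^TW_{R_i}\bar I_{u_i}\|^2+\|\bar I_{u_i}^TW_{R_i}\bar I_{u_i}\|)b_{0i},$$ $$\gamma_1=4\beta_{\bar x\psi},\quad \gamma_2=4(\beta_{\bar x\xi}+\beta_{\psi\xi}\gamma_1),\quad \gamma_3=4(\beta_{\psi x}\gamma_1+\beta_{\xi x}\gamma_2),\quad \sigma=\max_ib_{1i}+\gamma_2\max_ib_{2i}+\gamma_3\max_ib_{3i}.$$ **Theorem.** Under these assumptions there is exactly one NE $\boldsymbol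 x^*$; vectors $u_i,v_i$ and matrices $W_{c_i},W_{R_i},W_{\mathcal M}$ as above exist; and, for any such choice, the bound $\bar\alpha=\min\{\frac{l}{2N\sigma},\frac{\gamma_1}{8\sigma},\frac{\gamma_2}{8\sigma},1\}$ is positive and, for every $0<\alpha\le\bar\alpha$ and every initial condition, $\boldsymbol x(k)\to\boldsymbol x^*$ as $k\to\infty$. The convergence is linear: with $$\varepsilon=\min\Big\{\frac{l}{2\max_i\frac{n_i^3}{\alpha u_i^Tv_i}},\frac1{8\max_i\|W_{c_i}\|},\frac1{8\|W_{\mathcal M}\|},\frac1{4\max_i\|W_{R_i}\|}\Big\}\in(0,1)$$ there is, for every initial condition, a constant $K$ with $\|\boldsymbol x(k)-\boldsymbol x^*\|\le K(\sqrt{1-\varepsilon})^k$ for all $k\ge0$. -/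

import Mathlib

open Filter Topology
open scoped Matrix Kronecker

noncomputable section

namespace CoalitionGame

variable {N : ℕ} {n : Fin N → ℕ}

/-- The agents: agent `⟨i, j⟩` is the `j`-th agent of coalition `i`; coalition `i` has `n i` agents. -/
abbrev Agent (n : Fin N → ℕ) : Type := Σ i : Fin N, Fin (n i)

/-- The space of collective states, with the Euclidean norm. -/
abbrev State (n : Fin N → ℕ) : Type := EuclideanSpace ℝ (Agent n)

/-- The total number of agents. -/
def nSum (n : Fin N → ℕ) : ℕ := ∑ i, n i

/-! ### The game -/

/-- The cost of coalition `i` is the sum of the costs of its agents. -/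
def coalitionCost (f : Agent n → State n → ℝ) (i : Fin N) (x : State n) : ℝ :=
  ∑ j : Fin (n i), f ⟨i, j⟩ x

/-- The collective states in which each coalition has reached an agreement. -/
def consensusSet (n : Fin N → ℕ) : Set (State n) :=
  {x | ∀ i : Fin N, ∃ θ : ℝ, ∀ j : Fin (n i), x ⟨i, j⟩ = θ}

/-- Nash equilibrium of the consistency-constrained game: no coalition can lower its cost by
moving to another common state while the other coalitions keep theirs. -/
def IsNashEquilibrium (f : Agent n → State n → ℝ) (x : State n) : Prop :=
  x ∈ consensusSet n ∧
    ∀ (i : Fin N) (z : State n), (∀ a : Agent n, a.1 ≠ i → z a = x a) →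
      (∃ θ : ℝ, ∀ j : Fin (n i), z ⟨i, j⟩ = θ) →
      coalitionCost f i x ≤ coalitionCost f i z

/-- The collective state in which all agents of coalition `i` have the state `y i`. -/
def spread (n : Fin N → ℕ) (y : EuclideanSpace ℝ (Fin N)) : State n :=
  WithLp.toLp 2 fun a => y a.1

/-- The cost of coalition `i` as a function of the common states of the coalitions. -/
def virtualCost (f : Agent n → State n → ℝ) (i : Fin N) (y : EuclideanSpace ℝ (Fin N)) : ℝ :=
  coalitionCost f i (spread n y)

/-- The pseudo-gradient: its `i`-th entry is the `i`-th partial derivative of the cost of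
coalition `i`. -/
def pseudoGradient (f : Agent n → State n → ℝ) (y : EuclideanSpace ℝ (Fin N)) :
    EuclideanSpace ℝ (Fin N) :=
  WithLp.toLp 2 fun i => (gradient (virtualCost f i) y) i

/-! ### The network -/

/-- There is a directed path from every node to every other node. -/
def StronglyConnected {V : Type*} (G : Digraph V) : Prop :=
  ∀ a b : V, Relation.ReflTransGen G.Adj a b

/-- The subgraph induced on coalition `i`. -/
def coalitionGraph (G : Digraph (Agent n)) (i : Fin N) : Digraph (Fin (n i)) where
  Adj j m := G.Adj ⟨i, j⟩ ⟨i, m⟩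

open Classical in
/-- Adjacency matrix: the entry `(a, b)` is `1` if `b ≠ a` and there is an edge from `b` to `a`
(so that `a` receives information from `b`). -/
def adj (G : Digraph (Agent n)) : Matrix (Agent n) (Agent n) ℝ :=
  Matrix.of fun a b => if G.Adj b a ∧ b ≠ a then 1 else 0

/-- The in-degree. -/
def inDeg (G : Digraph (Agent n)) (a : Agent n) : ℝ := ∑ b, adj G a b

/-- The Laplacian matrix. -/
def laplacian (G : Digraph (Agent n)) : Matrix (Agent n) (Agent n) ℝ :=
  Matrix.diagonal (inDeg G) - adj G

/-- `R` is an admissible family of receiving weights: `R i j m` is the weight which agent `j` of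
coalition `i` gives to what it receives from agent `m` of the same coalition. It is positive if `m`
is `j` itself or an in-neighbour of `j`, and zero otherwise; each row sums to one. -/
def IsRowWeights (G : Digraph (Agent n)) (R : ∀ i, Matrix (Fin (n i)) (Fin (n i)) ℝ) : Prop :=
  ∀ i j, (∀ m, (m = j ∨ (coalitionGraph G i).Adj m j) → 0 < R i j m) ∧
    (∀ m, ¬ (m = j ∨ (coalitionGraph G i).Adj m j) → R i j m = 0) ∧
    ∑ m, R i j m = 1

/-- `C` is an admissible family of sending weights: `C i m j` is the weight which agent `j` of
coalition `i` attaches to what it sends to agent `m` of the same coalition. It is positive if `m`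
is `j` itself or an out-neighbour of `j`, and zero otherwise; each column sums to one. -/
def IsColWeights (G : Digraph (Agent n)) (C : ∀ i, Matrix (Fin (n i)) (Fin (n i)) ℝ) : Prop :=
  ∀ i j, (∀ m, (m = j ∨ (coalitionGraph G i).Adj j m) → 0 < C i m j) ∧
    (∀ m, ¬ (m = j ∨ (coalitionGraph G i).Adj j m) → C i m j = 0) ∧
    ∑ m, C i m j = 1

/-! ### The algorithm -/

/-- The variables of the algorithm: the states `x`, the gradient trackers `ψ` (`ψ i j l` is held by
agent `⟨i, j⟩` and belongs to the partial derivative with respect to the state of agent `⟨i, l⟩`),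
and the estimates `ξ` (`ξ a` is agent `a`'s estimate of the collective state). -/
structure Vars (n : Fin N → ℕ) where
  x : State n
  ψ : ∀ i : Fin N, Fin (n i) → Fin (n i) → ℝ
  ξ : Agent n → State n

/-- `trackedGrad f ξ i j l` is the partial derivative of the cost of agent `⟨i, j⟩` with respect to
the state of agent `⟨i, l⟩`, evaluated at the estimate held by agent `⟨i, j⟩`. -/
def trackedGrad (f : Agent n → State n → ℝ) (ξ : Agent n → State n) (i : Fin N)
    (j l : Fin (n i)) : ℝ :=
  (gradient (f ⟨i, j⟩) (ξ ⟨i, j⟩)) ⟨i, l⟩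

/-- The initial values: `x` and `ξ` are arbitrary, and `ψ` is determined by `ξ`. -/
def initVars (f : Agent n → State n → ℝ) (x₀ : State n) (ξ₀ : Agent n → State n) : Vars n where
  x := x₀
  ψ := trackedGrad f ξ₀
  ξ := ξ₀

open Classical in
/-- The update of the estimates. -/
def nextξ (G : Digraph (Agent n)) (s : Vars n) (a : Agent n) : State n :=
  WithLp.toLp 2 fun p =>
    s.ξ a p - 1 / (inDeg G a + adj G a p) *
      ((∑ b with G.Adj b a, (s.ξ a p - s.ξ b p)) + adj G a p * (s.ξ a p - s.x p))

/-- One iteration of the algorithm with step size `α`. -/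
def nextVars (G : Digraph (Agent n)) (R C : ∀ i, Matrix (Fin (n i)) (Fin (n i)) ℝ)
    (f : Agent n → State n → ℝ) (α : ℝ) (s : Vars n) : Vars n where
  x := WithLp.toLp 2 fun a =>
    (∑ m, R a.1 a.2 m * s.x ⟨a.1, m⟩) - α / (n a.1 : ℝ) * ∑ m, s.ψ a.1 a.2 m
  ψ i j l := (∑ m, C i j m * s.ψ i m l) + trackedGrad f (nextξ G s) i j l - trackedGrad f s.ξ i j l
  ξ := nextξ G s

/-- The variables after `k` iterations, started from the states `x₀` and the estimates `ξ₀`. -/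
def run (G : Digraph (Agent n)) (R C : ∀ i, Matrix (Fin (n i)) (Fin (n i)) ℝ)
    (f : Agent n → State n → ℝ) (α : ℝ) (x₀ : State n) (ξ₀ : Agent n → State n) : ℕ → Vars n
  | 0 => initVars f x₀ ξ₀
  | k + 1 => nextVars G R C f α (run G R C f α x₀ ξ₀ k)

/-! ### The bound on the step size -/

/-- The spectral norm of a square real matrix. -/
def specNorm {ι : Type*} [Fintype ι] [DecidableEq ι] (A : Matrix ι ι ℝ) : ℝ :=
  ‖Matrix.toEuclideanCLM (n := ι) (𝕜 := ℝ) A‖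

/-- The Euclidean norm of a real vector. -/
def vecNorm {ι : Type*} [Fintype ι] (v : ι → ℝ) : ℝ := ‖WithLp.toLp 2 v‖

/-- `W` is a symmetric positive definite solution of the discrete Lyapunov equation
`Aᵀ W A - W = -I`. -/
def IsLyapunovMatrix {ι : Type*} [Fintype ι] [DecidableEq ι] (A W : Matrix ι ι ℝ) : Prop :=
  W.PosDef ∧ Aᵀ * W * A - W = -1

/-- The diagonal matrix with the entries `1 / (d_a + a_{a p})`. -/
def gammaMat (G : Digraph (Agent n)) : Matrix (Agent n × Agent n) (Agent n × Agent n) ℝ :=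
  Matrix.diagonal fun q => 1 / (inDeg G q.1 + adj G q.1 q.2)

/-- The diagonal matrix with the entries `a_{a p}`. -/
def adjDiag (G : Digraph (Agent n)) : Matrix (Agent n × Agent n) (Agent n × Agent n) ℝ :=
  Matrix.diagonal fun q => adj G q.1 q.2

/-- `Γ (L ⊗ I + A_d)`. -/
def estMat (G : Digraph (Agent n)) : Matrix (Agent n × Agent n) (Agent n × Agent n) ℝ :=
  gammaMat G * (laplacian G ⊗ₖ (1 : Matrix (Agent n) (Agent n) ℝ) + adjDiag G)

/-- `M = I - Γ (L ⊗ I + A_d)`. -/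
def errMat (G : Digraph (Agent n)) : Matrix (Agent n × Agent n) (Agent n × Agent n) ℝ :=
  1 - estMat G

/-- `1 uᵀ / m`, of size `m`. -/
def leftProj {m : ℕ} (u : Fin m → ℝ) : Matrix (Fin m) (Fin m) ℝ :=
  (1 / (m : ℝ)) • Matrix.vecMulVec (fun _ => (1 : ℝ)) u

/-- `v 1ᵀ / m`, of size `m`. -/
def rightProj {m : ℕ} (v : Fin m → ℝ) : Matrix (Fin m) (Fin m) ℝ :=
  (1 / (m : ℝ)) • Matrix.vecMulVec v (fun _ => (1 : ℝ))

/-- The eigenvectors and Lyapunov matrices in terms of which the bound on the step size is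
expressed. -/
structure Spectral (n : Fin N → ℕ) where
  u : ∀ i, Fin (n i) → ℝ
  v : ∀ i, Fin (n i) → ℝ
  Wc : ∀ i, Matrix (Fin (n i)) (Fin (n i)) ℝ
  WR : ∀ i, Matrix (Fin (n i)) (Fin (n i)) ℝ
  WM : Matrix (Agent n × Agent n) (Agent n × Agent n) ℝ

/-- The defining properties: `u i` is the left eigenvector of `R i` and `v i` the right eigenvector
of `C i` for the eigenvalue one, both with entries that sum to `n i`, and the matrices solve the
Lyapunov equations of `C i - v i 1ᵀ / n i`, of `R i - 1 (u i)ᵀ / n i` and of `M`. -/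
structure Spectral.IsFor (S : Spectral n) (G : Digraph (Agent n))
    (R C : ∀ i, Matrix (Fin (n i)) (Fin (n i)) ℝ) : Prop where
  u_eigen : ∀ i, S.u i ᵥ* R i = S.u i
  u_sum : ∀ i, ∑ j, S.u i j = n i
  v_eigen : ∀ i, C i *ᵥ S.v i = S.v i
  v_sum : ∀ i, ∑ j, S.v i j = n i
  Wc_lyap : ∀ i, IsLyapunovMatrix (C i - rightProj (S.v i)) (S.Wc i)
  WR_lyap : ∀ i, IsLyapunovMatrix (R i - leftProj (S.u i)) (S.WR i)
  WM_lyap : IsLyapunovMatrix (errMat G) S.WM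

section Constants

variable (G : Digraph (Agent n)) (R C : ∀ i, Matrix (Fin (n i)) (Fin (n i)) ℝ)
  (lip : Agent n → ℝ) (l : ℝ) (S : Spectral n)

/-- `∑ⱼ l_{ij}²`. -/
def lipSq (i : Fin N) : ℝ := ∑ j : Fin (n i), lip ⟨i, j⟩ ^ 2

def βψξ : ℝ :=
  2 * (⨆ a : Agent n,
    (2 * specNorm ((C a.1 - rightProj (S.v a.1))ᵀ * S.Wc a.1 * (1 - rightProj (S.v a.1))) ^ 2
      + specNorm ((1 - rightProj (S.v a.1))ᵀ * S.Wc a.1 * (1 - rightProj (S.v a.1))))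
      * lip a ^ 2) * specNorm (estMat G) ^ 2

def βψx : ℝ := nSum n * βψξ G C lip S

/-- `4 ‖Mᵀ W_M‖² + 2 ‖W_M‖`. -/
def κM : ℝ := 4 * specNorm ((errMat G)ᵀ * S.WM) ^ 2 + 2 * specNorm S.WM

def βξx : ℝ := nSum n * κM G S * specNorm (estMat G) ^ 2

def βxψ : ℝ :=
  2 / l * ⨆ i : Fin N, (n i : ℝ) ^ 3 * vecNorm (S.u i) ^ 2 / (S.u i ⬝ᵥ S.v i) ^ 2

def βxξ : ℝ := 2 * (⨆ i : Fin N, (n i : ℝ) * lipSq lip i) / l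

def b₀ (i : Fin N) : ℝ :=
  (n i : ℝ) + (1 / (n i : ℝ) + ⨆ p : Fin N, (n p : ℝ)) * vecNorm (S.v i) ^ 2 * lipSq lip i

def b₁ (i : Fin N) : ℝ :=
  vecNorm (S.u i) ^ 2 / ((n i : ℝ) * (S.u i ⬝ᵥ S.v i)) * b₀ lip S i

def b₂ (i : Fin N) : ℝ :=
  nSum n * κM G S * specNorm ((1 / (n i : ℝ)) • leftProj (S.u i)) ^ 2 * b₀ lip S i

def b₃ (i : Fin N) : ℝ :=
  1 / (n i : ℝ) ^ 2 *
    (2 * specNorm ((R i - leftProj (S.u i))ᵀ * S.WR i * (1 - leftProj (S.u i))) ^ 2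
      + specNorm ((1 - leftProj (S.u i))ᵀ * S.WR i * (1 - leftProj (S.u i)))) * b₀ lip S i

def γ₁ : ℝ := 4 * βxψ l S

def γ₂ : ℝ := 4 * (βxξ (n := n) lip l + βψξ G C lip S * γ₁ l S)

def γ₃ : ℝ := 4 * (βψx G C lip S * γ₁ l S + βξx G S * γ₂ G C lip l S)

def sigma : ℝ :=
  (⨆ i, b₁ lip S i) + γ₂ G C lip l S * (⨆ i, b₂ G lip S i)
    + γ₃ G C lip l S * (⨆ i, b₃ R lip S i)

/-- The bound on the step size. -/
def stepBound : ℝ :=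
  min (min (l / (2 * N * sigma G R C lip l S)) (γ₁ l S / (8 * sigma G R C lip l S)))
    (min (γ₂ G C lip l S / (8 * sigma G R C lip l S)) 1)

/-- The decay parameter `ε` of the linear rate for the step size `α`. -/
def decay (α : ℝ) : ℝ :=
  min (min (l / (2 * ⨆ i : Fin N, (n i : ℝ) ^ 3 / (α * (S.u i ⬝ᵥ S.v i))))
      (1 / (8 * ⨆ i, specNorm (S.Wc i))))
    (min (1 / (8 * specNorm S.WM)) (1 / (4 * ⨆ i, specNorm (S.WR i))))

end Constants

end CoalitionGame

end

/-! The proof rests on the Lyapunov function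

`V = ∑ᵢ nᵢ³ / (α uᵢᵀvᵢ) (x̄ᵢ - yᵢ)² + γ₁ V_ψ + γ₂ V_ξ + γ₃ V_x`   (`energy`),

where `spread n y` is the equilibrium and `x̄ᵢ = uᵢᵀxᵢ / nᵢ` is the weighted average of the states of
coalition `i`. The other three terms are quadratic forms, given by the Lyapunov matrices, in the
tracking errors (how far the search directions `φᵢⱼ = ∑ₘ ψᵢⱼᵐ` of a coalition are from being
proportional to `vᵢ`), in the estimation errors `ξ - 1 ⊗ x̄`, and in the disagreements
`xᵢ - x̄ᵢ 1`. The states depend on the trackers only through the sums `φᵢⱼ`, and because the columns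
of `C` sum to one, `∑ⱼ φᵢⱼ` is at all times the sum over the coalition of the slopes at the
estimates (`isTracking_run`). If there were no errors this would be the pseudo-gradient at `x̄`, and
strong monotonicity would contract the first term. The errors obey linear recursions whose matrices
are those of the Lyapunov equations, perturbed by the other errors and by `α φᵢ`
(`disagreement_nextVars`, `trackErr_nextVars`, `estErr_nextVars`), so that each of the four terms
decreases up to controlled multiples of the others (`avgEnergy_nextVars_le` and the three lemmas
like it). The bound `‖φᵢ‖² ≤ b₀ᵢ (…)` of `trackSum_sq_le` makes the perturbations by `α φᵢ` harmless
for small `α`, and with the weights `γ₁, γ₂, γ₃` the cross terms are absorbed: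
`V(k+1) ≤ (1 - ε) V(k)` (`energy_nextVars_le`).

The equilibria are the consensus states at which the pseudo-gradient vanishes
(`isNashEquilibrium_iff`; convexity makes the first-order condition sufficient). A Lipschitz
strongly monotone map has a zero by the contraction principle
(`exists_zero_of_strongly_monotone`).

Lyapunov matrices exist for matrices whose powers tend to zero (`exists_isLyapunovMatrix`). For
`Rᵢ - 1uᵢᵀ/nᵢ` and `(Cᵢ - vᵢ1ᵀ/nᵢ)ᵀ` this is the convergence of an ergodic Markov chain
(`IsErgodic.exists_tendsto_sub_limit`). For `errMat G`, a substochastic matrix, the row sums of the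
powers drop below one along the paths that start from the agent whose state is estimated
(`exists_tendsto_errMat`). -/

namespace CoalitionGame

/-! ### Spectral norms and Lyapunov matrices -/

section LinearAlgebra

variable {ι : Type*} [Fintype ι]

lemma vecNorm_sq (v : ι → ℝ) : vecNorm v ^ 2 = v ⬝ᵥ v := by
  rw [vecNorm, EuclideanSpace.real_norm_sq_eq]
  simp [dotProduct, sq]

lemma dotProduct_self_nonneg_real (v : ι → ℝ) : 0 ≤ v ⬝ᵥ v := by
  rw [← vecNorm_sq]; positivity

lemma dotProduct_sq_le (x y : ι → ℝ) : (x ⬝ᵥ y) ^ 2 ≤ (x ⬝ᵥ x) * (y ⬝ᵥ y) := by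
  simpa [dotProduct, sq] using Finset.sum_mul_sq_le_sq_mul_sq Finset.univ x y

lemma dotProduct_add_self_le (x y : ι → ℝ) :
    (x + y) ⬝ᵥ (x + y) ≤ 2 * (x ⬝ᵥ x) + 2 * (y ⬝ᵥ y) := by
  have h := dotProduct_self_nonneg_real (x - y)
  simp only [add_dotProduct, dotProduct_add, sub_dotProduct, dotProduct_sub] at h ⊢
  linarith

lemma two_mul_dotProduct_le (x y : ι → ℝ) :
    2 * (x ⬝ᵥ y) ≤ 1 / 2 * (x ⬝ᵥ x) + 2 * (y ⬝ᵥ y) := by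
  have h := dotProduct_self_nonneg_real (x - (2 : ℝ) • y)
  simp only [sub_dotProduct, dotProduct_sub, smul_dotProduct, dotProduct_smul, smul_eq_mul] at h
  rw [dotProduct_comm y x] at h
  linarith

lemma mulVec_dotProduct_mulVec_mulVec (A W E : Matrix ι ι ℝ) (x y : ι → ℝ) :
    (A *ᵥ x) ⬝ᵥ (W *ᵥ (E *ᵥ y)) = x ⬝ᵥ ((Aᵀ * W * E) *ᵥ y) := by
  rw [← Matrix.mulVec_mulVec, ← Matrix.mulVec_mulVec, Matrix.dotProduct_mulVec x,
    Matrix.vecMul_transpose]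

variable [DecidableEq ι]

lemma specNorm_nonneg (A : Matrix ι ι ℝ) : 0 ≤ specNorm A := norm_nonneg _

lemma mulVec_dotProduct_self_le (A : Matrix ι ι ℝ) (x : ι → ℝ) :
    (A *ᵥ x) ⬝ᵥ (A *ᵥ x) ≤ specNorm A ^ 2 * (x ⬝ᵥ x) := by
  have h := (Matrix.toEuclideanCLM (n := ι) (𝕜 := ℝ) A).le_opNorm (WithLp.toLp 2 x)
  rw [Matrix.toEuclideanCLM_toLp] at h
  rw [← vecNorm_sq, ← vecNorm_sq, ← mul_pow]
  exact pow_le_pow_left₀ (norm_nonneg _) h 2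

lemma dotProduct_mulVec_self_le (A : Matrix ι ι ℝ) (x : ι → ℝ) :
    x ⬝ᵥ A *ᵥ x ≤ specNorm A * (x ⬝ᵥ x) := by
  refine abs_le_of_sq_le_sq' ?_ (mul_nonneg (specNorm_nonneg A) (dotProduct_self_nonneg_real x)) |>.2
  calc (x ⬝ᵥ A *ᵥ x) ^ 2 ≤ (x ⬝ᵥ x) * ((A *ᵥ x) ⬝ᵥ (A *ᵥ x)) := dotProduct_sq_le _ _
    _ ≤ (x ⬝ᵥ x) * (specNorm A ^ 2 * (x ⬝ᵥ x)) :=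
        mul_le_mul_of_nonneg_left (mulVec_dotProduct_self_le A x) (dotProduct_self_nonneg_real x)
    _ = _ := by ring

namespace IsLyapunovMatrix

variable {A W : Matrix ι ι ℝ}

lemma transpose_eq (h : IsLyapunovMatrix A W) : Wᵀ = W := by
  simpa [Matrix.IsHermitian] using h.1.isHermitian

lemma mulVec_energy (h : IsLyapunovMatrix A W) (x : ι → ℝ) :
    (A *ᵥ x) ⬝ᵥ (W *ᵥ (A *ᵥ x)) = x ⬝ᵥ W *ᵥ x - x ⬝ᵥ x := by
  have e : Aᵀ * W * A = W - 1 := by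
    have := h.2
    rw [sub_eq_iff_eq_add] at this
    rw [this]; abel
  rw [mulVec_dotProduct_mulVec_mulVec, e, Matrix.sub_mulVec, dotProduct_sub, Matrix.one_mulVec]

/-- The quadratic form of a Lyapunov matrix decreases along the perturbed iteration
`z ↦ A z + E d` up to a multiple of the squared norm of the perturbation. -/
lemma perturbed_step (h : IsLyapunovMatrix A W) (E : Matrix ι ι ℝ) (z d : ι → ℝ) :
    (A *ᵥ z + E *ᵥ d) ⬝ᵥ (W *ᵥ (A *ᵥ z + E *ᵥ d)) ≤
      z ⬝ᵥ W *ᵥ z - 1 / 2 * (z ⬝ᵥ z) +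
        (2 * specNorm (Aᵀ * W * E) ^ 2 + specNorm (Eᵀ * W * E)) * (d ⬝ᵥ d) := by
  have e1 : (E *ᵥ d) ⬝ᵥ (W *ᵥ (A *ᵥ z)) = (A *ᵥ z) ⬝ᵥ (W *ᵥ (E *ᵥ d)) := by
    rw [Matrix.dotProduct_mulVec, ← Matrix.mulVec_transpose, h.transpose_eq, dotProduct_comm]
  have e2 := two_mul_dotProduct_le z ((Aᵀ * W * E) *ᵥ d)
  have e3 := mulVec_dotProduct_self_le (Aᵀ * W * E) d
  have e4 := dotProduct_mulVec_self_le (Eᵀ * W * E) d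
  rw [Matrix.mulVec_add, add_dotProduct, dotProduct_add, dotProduct_add, h.mulVec_energy, e1,
    mulVec_dotProduct_mulVec_mulVec, mulVec_dotProduct_mulVec_mulVec]
  linarith

lemma dotProduct_self_le (h : IsLyapunovMatrix A W) (x : ι → ℝ) : x ⬝ᵥ x ≤ x ⬝ᵥ W *ᵥ x := by
  have h1 := h.mulVec_energy x
  have h2 := h.1.posSemidef.dotProduct_mulVec_nonneg (A *ᵥ x)
  simp only [star_trivial] at h2
  linarith

lemma one_le_specNorm [Nonempty ι] (h : IsLyapunovMatrix A W) : 1 ≤ specNorm W := by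
  have h1 := (h.dotProduct_self_le (fun _ => 1)).trans (dotProduct_mulVec_self_le W _)
  have h2 : (0 : ℝ) < (fun _ : ι => (1 : ℝ)) ⬝ᵥ fun _ => 1 := by
    simp [dotProduct, Fintype.card_pos]
  exact le_of_mul_le_mul_right (by linarith) h2

end IsLyapunovMatrix

open scoped Matrix.Norms.L2Operator in
/-- The Lyapunov matrix is `∑ₖ (Bᵀ)ᵏ Bᵏ`. -/
lemma exists_isLyapunovMatrix_of_specNorm_lt_one {B : Matrix ι ι ℝ} (hB : specNorm B < 1) :
    ∃ W, IsLyapunovMatrix B W := by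
  change ‖B‖ < 1 at hB
  have hT : ‖Bᵀ‖ = ‖B‖ := by
    rw [← Matrix.conjTranspose_eq_transpose_of_trivial, Matrix.l2_opNorm_conjTranspose]
  have hs : Summable fun k : ℕ => (Bᵀ) ^ k * B ^ k := by
    refine Summable.of_norm_bounded_eventually
      (g := fun k => (‖B‖ * ‖B‖) ^ k) (summable_geometric_of_lt_one (by positivity)
        (by nlinarith [norm_nonneg B])) ?_
    rw [Nat.cofinite_eq_atTop]
    filter_upwards [eventually_gt_atTop 0] with k hk
    refine (norm_mul_le _ _).trans ?_
    rw [mul_pow]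
    have h1 := norm_pow_le' Bᵀ hk
    rw [hT] at h1
    exact mul_le_mul h1 (norm_pow_le' B hk) (norm_nonneg _) (by positivity)
  set W := ∑' k : ℕ, (Bᵀ) ^ k * B ^ k with hW
  have hsum : HasSum (fun k : ℕ => (Bᵀ) ^ k * B ^ k) W := hs.hasSum
  have hLy : Bᵀ * W * B - W = -1 := by
    have h1 : HasSum (fun k : ℕ => Bᵀ * ((Bᵀ) ^ k * B ^ k) * B) (Bᵀ * W * B) :=
      (hsum.mul_left _).mul_right _
    have h2 : HasSum (fun k : ℕ => (Bᵀ) ^ (k + 1) * B ^ (k + 1)) (Bᵀ * W * B) := by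
      convert h1 using 2 with k
      rw [pow_succ' Bᵀ, pow_succ B]; simp only [mul_assoc]
    have h3 := (hasSum_nat_add_iff' 1).2 hsum
    rw [h2.unique h3]; simp
  refine ⟨W, ?_, hLy⟩
  have hherm : Wᴴ = W := by
    rw [Matrix.conjTranspose_eq_transpose_of_trivial]
    refine HasSum.unique (hsum.matrix_transpose) ?_
    simpa [Matrix.transpose_mul, Matrix.transpose_pow] using hsum
  refine Matrix.PosDef.of_dotProduct_mulVec_pos hherm fun x hx => ?_
  have hq : HasSum (fun k : ℕ => (B ^ k *ᵥ x) ⬝ᵥ (B ^ k *ᵥ x)) (x ⬝ᵥ W *ᵥ x) := by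
    have hc : Continuous fun X : Matrix ι ι ℝ => x ⬝ᵥ X *ᵥ x := by fun_prop
    let φ : Matrix ι ι ℝ →+ ℝ :=
      { toFun := fun X => x ⬝ᵥ X *ᵥ x
        map_zero' := by simp
        map_add' := fun X Y => by rw [Matrix.add_mulVec, dotProduct_add] }
    refine (hsum.map φ hc).congr_fun fun k => ?_
    have := mulVec_dotProduct_mulVec_mulVec (B ^ k) 1 (B ^ k) x x
    simpa [Matrix.transpose_pow, φ] using this
  -- The term `k = 0` of the series is already positive.
  have h0 := le_hasSum hq 0 fun k _ => dotProduct_self_nonneg_real _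
  have h1 : 0 < x ⬝ᵥ x :=
    lt_of_le_of_ne (dotProduct_self_nonneg_real x) fun h => hx (dotProduct_self_eq_zero.1 h.symm)
  simp only [pow_zero, Matrix.one_mulVec] at h0
  exact h1.trans_le h0

/-- If the powers of `A ^ m` tend to zero, then some power `A ^ p` has norm less than one and hence a
Lyapunov matrix `W`, and `∑ j < p, (Aᵀ)ʲ W Aʲ` is a Lyapunov matrix of `A` by telescoping. -/
lemma exists_isLyapunovMatrix {A : Matrix ι ι ℝ} {m : ℕ} (hm : 0 < m)
    (h : Tendsto (fun k : ℕ => (A ^ m) ^ k) atTop (𝓝 0)) : ∃ W, IsLyapunovMatrix A W := by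
  obtain ⟨k, hk, hk0⟩ : ∃ k : ℕ, specNorm ((A ^ m) ^ k) < 1 ∧ 0 < k := by
    have hc : Continuous fun X : Matrix ι ι ℝ => specNorm X := by
      open scoped Matrix.Norms.L2Operator in exact continuous_norm
    have h1 := (hc.tendsto 0).comp h
    have h2 : specNorm (0 : Matrix ι ι ℝ) < 1 := by simp [specNorm]
    exact ((h1.eventually (gt_mem_nhds h2)).and (eventually_gt_atTop 0)).exists
  rw [← pow_mul] at hk
  obtain ⟨W, hW⟩ := exists_isLyapunovMatrix_of_specNorm_lt_one hk
  set p := m * k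
  have hp : 0 < p := Nat.mul_pos hm hk0
  refine ⟨∑ j ∈ Finset.range p, (Aᵀ) ^ j * W * A ^ j, ?_, ?_⟩
  · obtain ⟨q, hq⟩ : ∃ q, p = q + 1 := ⟨p - 1, by omega⟩
    rw [hq, Finset.sum_range_succ', add_comm]
    refine Matrix.PosDef.add_posSemidef (by simpa using hW.1) ?_
    refine Matrix.posSemidef_sum _ fun j _ => ?_
    have := hW.1.posSemidef.conjTranspose_mul_mul_same (A ^ (j + 1))
    simpa [Matrix.conjTranspose_eq_transpose_of_trivial, Matrix.transpose_pow] using this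
  · have e : ∀ q : ℕ, Aᵀ * (∑ j ∈ Finset.range q, (Aᵀ) ^ j * W * A ^ j) * A -
        ∑ j ∈ Finset.range q, (Aᵀ) ^ j * W * A ^ j = (Aᵀ) ^ q * W * A ^ q - W := by
      intro q
      have h0 := Finset.sum_range_sub (fun j => (Aᵀ) ^ j * W * A ^ j) q
      rw [pow_zero, pow_zero, one_mul, mul_one] at h0
      rw [Finset.mul_sum, Finset.sum_mul, ← Finset.sum_sub_distrib, ← h0]
      refine Finset.sum_congr rfl fun j _ => ?_
      rw [pow_succ' Aᵀ, pow_succ A]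
      simp only [mul_assoc]
    rw [e, ← Matrix.transpose_pow, hW.2]

end LinearAlgebra

/-! ### Ergodic stochastic matrices -/

section Stochastic

variable {ι : Type*} [Fintype ι]

lemma pow_entry_nonneg [DecidableEq ι] {Q : Matrix ι ι ℝ} (hQ : ∀ i j, 0 ≤ Q i j) (k : ℕ) (i j : ι) :
    0 ≤ (Q ^ k) i j := by
  induction k generalizing i j with
  | zero => rw [pow_zero, Matrix.one_apply]; split_ifs <;> norm_num
  | succ k ih =>
    rw [pow_succ, Matrix.mul_apply]
    exact Finset.sum_nonneg fun m _ => mul_nonneg (ih i m) (hQ m j)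

lemma tendsto_pow_zero_of_rowSum_le [DecidableEq ι] {Q : Matrix ι ι ℝ} (hQ : ∀ i j, 0 ≤ Q i j) {c : ℝ}
    (hc0 : 0 ≤ c) (hc : c < 1) (h : ∀ i, ∑ j, Q i j ≤ c) :
    Tendsto (fun k : ℕ => Q ^ k) atTop (𝓝 0) := by
  have hrow : ∀ (k : ℕ) (i : ι), ∑ j, (Q ^ k) i j ≤ c ^ k := by
    intro k
    induction k with
    | zero => intro i; simp [Matrix.one_apply]
    | succ k ih =>
      intro i
      calc ∑ j, (Q ^ (k + 1)) i j = ∑ m, (Q ^ k) i m * ∑ j, Q m j := by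
            simp only [pow_succ, Matrix.mul_apply]
            rw [Finset.sum_comm]
            simp only [Finset.mul_sum]
        _ ≤ ∑ m, (Q ^ k) i m * c :=
            Finset.sum_le_sum fun m _ =>
              mul_le_mul_of_nonneg_left (h m) (pow_entry_nonneg hQ k i m)
        _ = (∑ m, (Q ^ k) i m) * c := by rw [Finset.sum_mul]
        _ ≤ c ^ k * c := mul_le_mul_of_nonneg_right (ih i) hc0
        _ = c ^ (k + 1) := (pow_succ c k).symm
  refine tendsto_pi_nhds.2 fun i => tendsto_pi_nhds.2 fun j => ?_
  refine squeeze_zero (fun k => pow_entry_nonneg hQ k i j) (fun k => ?_)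
    (tendsto_pow_atTop_nhds_zero_of_lt_one hc0 hc)
  exact (Finset.single_le_sum (f := fun j => (Q ^ k) i j)
    (fun m _ => pow_entry_nonneg hQ k i m) (Finset.mem_univ j)).trans (hrow k i)

/-- Row-stochastic matrices with positive diagonal whose graph of positive entries is strongly
connected. -/
structure IsErgodic (A : Matrix ι ι ℝ) : Prop where
  nonneg : ∀ i j, 0 ≤ A i j
  rowSum : ∀ i, ∑ j, A i j = 1
  diag_pos : ∀ i, 0 < A i i
  connected : ∀ i j, Relation.ReflTransGen (fun a b => 0 < A a b) i j

namespace IsErgodic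

variable {A : Matrix ι ι ℝ}

lemma mulVec_one (h : IsErgodic A) : A *ᵥ (fun _ => 1) = fun _ => 1 := by
  ext i; simpa [Matrix.mulVec, dotProduct] using h.rowSum i

variable [DecidableEq ι]

lemma pow_mulVec_one (h : IsErgodic A) (k : ℕ) : A ^ k *ᵥ (fun _ => 1) = fun _ => 1 := by
  induction k with
  | zero => simp
  | succ k ih => rw [pow_succ, ← Matrix.mulVec_mulVec, h.mulVec_one, ih]

lemma exists_pow_pos (h : IsErgodic A) : ∃ m : ℕ, 0 < m ∧ ∀ i j, 0 < (A ^ m) i j := by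
  have step : ∀ (k : ℕ) (i j l : ι), 0 < (A ^ k) i j → 0 < A j l → 0 < (A ^ (k + 1)) i l := by
    intro k i j l h1 h2
    rw [pow_succ, Matrix.mul_apply]
    exact Finset.sum_pos' (fun m _ => mul_nonneg (pow_entry_nonneg h.nonneg k i m) (h.nonneg m l))
      ⟨j, Finset.mem_univ j, mul_pos h1 h2⟩
  have ev : ∀ i j, ∀ᶠ k in atTop, 0 < (A ^ k) i j := by
    intro i j
    obtain ⟨k, hk⟩ : ∃ k : ℕ, 0 < (A ^ k) i j := by
      induction h.connected i j with
      | refl => exact ⟨0, by simp⟩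
      | tail _ hbc ih =>
        obtain ⟨k, hk⟩ := ih
        exact ⟨k + 1, step k _ _ _ hk hbc⟩
    filter_upwards [eventually_ge_atTop k] with q hq
    induction q, hq using Nat.le_induction with
    | base => exact hk
    | succ q _ ih => exact step q _ _ _ ih (h.diag_pos j)
  obtain ⟨m, h1, h2⟩ := ((eventually_gt_atTop 0).and
    (eventually_all.2 fun i => eventually_all.2 fun j => ev i j)).exists
  exact ⟨m, h1, h2⟩

/-- Some power of an ergodic matrix agrees, on matrices whose rows sum to zero, with a matrix whose
powers tend to zero: subtract from the entrywise positive power a small constant in every entry. -/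
lemma exists_contraction (h : IsErgodic A) : ∃ (m : ℕ) (Q : Matrix ι ι ℝ), 0 < m ∧
    Tendsto (fun k : ℕ => Q ^ k) atTop (𝓝 0) ∧
    ∀ Z : Matrix ι ι ℝ, Z *ᵥ (fun _ => 1) = 0 → ∀ k : ℕ, Z * (A ^ m) ^ k = Z * Q ^ k := by
  obtain ⟨m, hm, hpos⟩ := h.exists_pow_pos
  rcases isEmpty_or_nonempty ι with hι | hι
  · exact ⟨m, 0, hm, by simp [Subsingleton.elim (α := Matrix ι ι ℝ) _ 0],
      fun _ _ _ => Subsingleton.elim _ _⟩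
  obtain ⟨⟨i₀, j₀⟩, hmin⟩ := Finite.exists_min fun p : ι × ι => (A ^ m) p.1 p.2
  set δ := (A ^ m) i₀ j₀ with hδ
  have hδ0 : 0 < δ := hpos _ _
  let U : Matrix ι ι ℝ := Matrix.of fun _ _ => δ
  have hrow : ∀ i, ∑ j, (A ^ m) i j = 1 := fun i => by
    simpa [Matrix.mulVec, dotProduct] using congrFun (h.pow_mulVec_one m) i
  have hQ0 : ∀ i j, 0 ≤ (A ^ m - U) i j := fun i j => sub_nonneg.2 (hmin (i, j))
  have hQrow : ∀ i, ∑ j, (A ^ m - U) i j = 1 - Fintype.card ι * δ := fun i => by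
    simp [Matrix.sub_apply, Finset.sum_sub_distrib, hrow, U]
  have hcard : (0 : ℝ) < Fintype.card ι := by exact_mod_cast Fintype.card_pos
  refine ⟨m, A ^ m - U, hm, tendsto_pow_zero_of_rowSum_le hQ0 (c := 1 - Fintype.card ι * δ)
    ?_ (by nlinarith) fun i => (hQrow i).le, ?_⟩
  · rw [← hQrow i₀]
    exact Finset.sum_nonneg fun j _ => hQ0 i₀ j
  · intro Z hZ k
    induction k with
    | zero => simp
    | succ k ih =>
      have hZU : Z * (A ^ m) ^ k * U = 0 := by
        have e : (Z * (A ^ m) ^ k) *ᵥ (fun _ => (1 : ℝ)) = 0 := by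
          rw [← Matrix.mulVec_mulVec, ← pow_mul, h.pow_mulVec_one, hZ]
        ext i j
        have := congrFun e i
        simp only [Matrix.mulVec, dotProduct, mul_one, Pi.zero_apply] at this
        rw [Matrix.mul_apply]
        simp [U, ← Finset.sum_mul, this]
      rw [pow_succ, pow_succ, ← mul_assoc, ← mul_assoc, ← ih, mul_sub, hZU, sub_zero]

/-- A left fixed vector is determined by the sum of its entries. -/
lemma eq_zero_of_fixed (h : IsErgodic A) {x : ι → ℝ} (hx : x ᵥ* A = x) (hs : ∑ i, x i = 0) :
    x = 0 := by
  obtain ⟨m, Q, hm, hQ, hZ⟩ := h.exists_contraction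
  have hpow : ∀ k : ℕ, x ᵥ* A ^ k = x := by
    intro k
    induction k with
    | zero => simp
    | succ k ih => rw [pow_succ, ← Matrix.vecMul_vecMul, ih, hx]
  let Z : Matrix ι ι ℝ := Matrix.of fun _ => x
  have hZ1 : Z *ᵥ (fun _ => 1) = 0 := by
    ext i; simpa [Z, Matrix.mulVec, dotProduct] using hs
  have e : ∀ k : ℕ, Z * Q ^ k = Z := by
    intro k
    rw [← hZ Z hZ1 k, ← pow_mul]
    ext i j
    exact congrFun (hpow (m * k)) j
  have h1 : Tendsto (fun k : ℕ => Z * Q ^ k) atTop (𝓝 (Z * 0)) :=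
    ((continuous_const.matrix_mul continuous_id).tendsto 0).comp hQ
  simp only [e, mul_zero] at h1
  have h2 : Z = 0 := tendsto_nhds_unique tendsto_const_nhds h1
  ext i
  exact congrFun (congrFun h2 i) i

/-- The left eigenvalue one comes from the right eigenvector `1`. -/
lemma exists_fixed [Nonempty ι] (h : IsErgodic A) (s : ℝ) :
    ∃ u : ι → ℝ, u ᵥ* A = u ∧ ∑ i, u i = s := by
  have hdet : (A - 1).det = 0 := by
    refine Matrix.exists_mulVec_eq_zero_iff.1 ⟨fun _ => 1, ?_, ?_⟩
    · intro h0
      obtain ⟨i⟩ := ‹Nonempty ι›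
      exact one_ne_zero (congrFun h0 i)
    · rw [Matrix.sub_mulVec, h.mulVec_one, Matrix.one_mulVec, sub_self]
  obtain ⟨x, hx0, hx⟩ := Matrix.exists_vecMul_eq_zero_iff.2 hdet
  rw [Matrix.vecMul_sub, Matrix.vecMul_one, sub_eq_zero] at hx
  have hs : ∑ i, x i ≠ 0 := fun hs => hx0 (h.eq_zero_of_fixed hx hs)
  refine ⟨(s / ∑ i, x i) • x, by rw [Matrix.smul_vecMul, hx], ?_⟩
  simp only [Pi.smul_apply, smul_eq_mul, ← Finset.mul_sum]
  exact div_mul_cancel₀ s hs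

/-- Perron: the left fixed vectors with positive sum are entrywise positive. The vector of absolute
values is again fixed, hence proportional to the given one. -/
lemma fixed_pos (h : IsErgodic A) {u : ι → ℝ} (hu : u ᵥ* A = u) (hs : 0 < ∑ i, u i) (j : ι) :
    0 < u j := by
  set w : ι → ℝ := fun i => |u i| with hw
  have hle : ∀ j, w j ≤ (w ᵥ* A) j := by
    intro j
    have e := congrFun hu j
    simp only [Matrix.vecMul, dotProduct] at e ⊢
    calc |u j| = |∑ i, u i * A i j| := by rw [e]
      _ ≤ ∑ i, |u i * A i j| := Finset.abs_sum_le_sum_abs _ _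
      _ = ∑ i, |u i| * A i j := by simp only [abs_mul, abs_of_nonneg (h.nonneg _ _)]
  have hsum : ∑ j, (w ᵥ* A) j = ∑ j, w j := by
    simp only [Matrix.vecMul, dotProduct]
    rw [Finset.sum_comm]
    simp only [← Finset.mul_sum, h.rowSum, mul_one]
  have hwfix : w ᵥ* A = w := by
    ext j
    exact ((Finset.sum_eq_sum_iff_of_le fun j _ => hle j).1 hsum.symm j (Finset.mem_univ j)).symm
  have hwsum : 0 < ∑ i, w i := hs.trans_le (Finset.sum_le_sum fun i _ => le_abs_self (u i))
  have hprop : (∑ i, w i) • u - (∑ i, u i) • w = 0 := by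
    refine h.eq_zero_of_fixed ?_ ?_
    · rw [Matrix.sub_vecMul, Matrix.smul_vecMul, Matrix.smul_vecMul, hu, hwfix]
    · simp only [Pi.sub_apply, Pi.smul_apply, smul_eq_mul, Finset.sum_sub_distrib,
        ← Finset.mul_sum]
      ring
  have hnn : ∀ i, 0 ≤ u i := by
    intro i
    have e := congrFun hprop i
    simp only [Pi.sub_apply, Pi.smul_apply, smul_eq_mul, Pi.zero_apply, sub_eq_zero] at e
    exact nonneg_of_mul_nonneg_right (e ▸ mul_nonneg hs.le (abs_nonneg _)) hwsum
  obtain ⟨m, -, hpos⟩ := h.exists_pow_pos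
  have hpow : ∀ k : ℕ, u ᵥ* A ^ k = u := by
    intro k
    induction k with
    | zero => simp
    | succ k ih => rw [pow_succ, ← Matrix.vecMul_vecMul, ih, hu]
  obtain ⟨i, -, hi⟩ := Finset.exists_lt_of_sum_lt (s := Finset.univ) (f := fun _ : ι => (0 : ℝ))
    (g := u) (by simpa using hs)
  rw [← hpow m]
  exact Finset.sum_pos' (fun i _ => mul_nonneg (hnn i) (hpos i j).le)
    ⟨i, Finset.mem_univ i, mul_pos hi (hpos i j)⟩

/-- Subtracting from an ergodic matrix its limit `1 uᵀ / s` makes it stable. -/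
lemma exists_tendsto_sub_limit (h : IsErgodic A) {u : ι → ℝ} {s : ℝ} (hs : s ≠ 0)
    (hu : u ᵥ* A = u) (hus : ∑ i, u i = s) : ∃ m : ℕ, 0 < m ∧
    Tendsto (fun k : ℕ => ((A - (1 / s) • Matrix.vecMulVec (fun _ => (1 : ℝ)) u) ^ m) ^ k)
      atTop (𝓝 0) := by
  obtain ⟨m, Q, hm, hQ, hZ⟩ := h.exists_contraction
  refine ⟨m, hm, ?_⟩
  set J : Matrix ι ι ℝ := (1 / s) • Matrix.vecMulVec (fun _ => (1 : ℝ)) u with hJ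
  have hJ1 : J *ᵥ (fun _ => 1) = fun _ => 1 := by
    ext i
    simp only [hJ, Matrix.mulVec, dotProduct, Matrix.smul_apply, Matrix.vecMulVec_apply,
      smul_eq_mul, one_mul, mul_one, ← Finset.mul_sum, hus]
    exact one_div_mul_cancel hs
  have hAJ : A * J = J := by
    rw [hJ, Matrix.mul_smul, Matrix.mul_vecMulVec, h.mulVec_one]
  have hJA : J * A = J := by
    rw [hJ, Matrix.smul_mul, Matrix.vecMulVec_mul, hu]
  have hJJ : J * J = J := by
    nth_rw 2 [hJ]
    rw [Matrix.mul_smul, Matrix.mul_vecMulVec, hJ1]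
  have hE : (1 - J) *ᵥ (fun _ => (1 : ℝ)) = 0 := by
    rw [Matrix.sub_mulVec, hJ1, Matrix.one_mulVec, sub_self]
  have hpow : ∀ k : ℕ, (A - J) ^ (k + 1) = (1 - J) * A ^ (k + 1) := by
    intro k
    induction k with
    | zero => simp [sub_mul, hJA]
    | succ k ih =>
      have e : ∀ q : ℕ, J * A ^ q = J := by
        intro q
        induction q with
        | zero => simp
        | succ q ih => rw [pow_succ, ← mul_assoc, ih, hJA]
      have e' : ∀ q : ℕ, A ^ q * J = J := by
        intro q
        induction q with
        | zero => simp
        | succ q ih => rw [pow_succ, mul_assoc, hAJ, ih]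
      have e'' : ∀ q : ℕ, (1 - J) * A ^ q = A ^ q - J := fun q => by
        rw [sub_mul, one_mul, e]
      rw [pow_succ, ih, e'', e'', mul_sub, sub_mul, sub_mul, hJA, hJJ, e', ← pow_succ, sub_self,
        sub_zero]
  have h1 : Tendsto (fun k : ℕ => (1 - J) * Q ^ k) atTop (𝓝 ((1 - J) * 0)) :=
    ((continuous_const.matrix_mul continuous_id).tendsto 0).comp hQ
  rw [mul_zero] at h1
  refine h1.congr' ?_
  filter_upwards [eventually_gt_atTop 0] with k hk
  obtain ⟨q, hq⟩ : ∃ q, m * k = q + 1 := ⟨m * k - 1, by have := Nat.mul_pos hm hk; omega⟩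
  rw [← hZ _ hE, ← pow_mul, ← pow_mul, hq, hpow]

end IsErgodic

end Stochastic

/-! ### The network -/

section Network

variable {N : ℕ} {n : Fin N → ℕ}

lemma adj_nonneg (G : Digraph (Agent n)) (a b : Agent n) : 0 ≤ adj G a b := by
  classical
  rw [adj, Matrix.of_apply]; split_ifs <;> norm_num

lemma adj_eq_one {G : Digraph (Agent n)} {a b : Agent n} (h : G.Adj b a) (hne : b ≠ a) :
    adj G a b = 1 := by
  rw [adj, Matrix.of_apply, if_pos ⟨h, hne⟩]

lemma inDeg_nonneg (G : Digraph (Agent n)) (a : Agent n) : 0 ≤ inDeg G a :=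
  Finset.sum_nonneg fun b _ => adj_nonneg G a b

lemma estMat_mulVec (G : Digraph (Agent n)) (z : Agent n × Agent n → ℝ) (a p : Agent n) :
    (estMat G *ᵥ z) (a, p) = 1 / (inDeg G a + adj G a p) *
      ((∑ b, adj G a b * (z (a, p) - z (b, p))) + adj G a p * z (a, p)) := by
  have hk : ((laplacian G ⊗ₖ (1 : Matrix (Agent n) (Agent n) ℝ)) *ᵥ z) (a, p) =
      ∑ b, adj G a b * (z (a, p) - z (b, p)) := by
    simp only [Matrix.mulVec, dotProduct, Fintype.sum_prod_type, Matrix.kroneckerMap_apply,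
      Matrix.one_apply, mul_ite, mul_one, mul_zero, ite_mul, zero_mul, Finset.sum_ite_eq,
      Finset.mem_univ, if_true]
    simp only [laplacian, Matrix.sub_apply, sub_mul, Finset.sum_sub_distrib, mul_sub,
      Matrix.diagonal_apply, ite_mul, zero_mul, Finset.sum_ite_eq, Finset.mem_univ, if_true]
    rw [inDeg, Finset.sum_mul]
  rw [estMat, ← Matrix.mulVec_mulVec, gammaMat, Matrix.mulVec_diagonal, Matrix.add_mulVec,
    Pi.add_apply, hk, adjDiag, Matrix.mulVec_diagonal]

/-- The update of the estimates in matrix form. The matrix may be applied to `ξ - 1 ⊗ x` because the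
Laplacian vanishes on `1 ⊗ x`. -/
lemma nextξ_apply (G : Digraph (Agent n)) (s : Vars n) (a p : Agent n) :
    nextξ G s a p = s.ξ a p - (estMat G *ᵥ fun q => s.ξ q.1 q.2 - s.x q.2) (a, p) := by
  classical
  rw [estMat_mulVec]
  simp only [nextξ]
  congr 3
  rw [Finset.sum_filter]
  refine Finset.sum_congr rfl fun b _ => ?_
  by_cases h : G.Adj b a
  · by_cases hb : b = a
    · subst hb; simp
    · rw [adj_eq_one h hb, if_pos h]; ring
  · rw [if_neg h, adj, Matrix.of_apply, if_neg fun h' => h h'.1, zero_mul]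

lemma exists_ne (hcard : 2 ≤ nSum n) (a : Agent n) : ∃ b : Agent n, b ≠ a := by
  have : 1 < Fintype.card (Agent n) := by
    simpa [nSum] using (by omega : 1 < nSum n)
  exact Fintype.exists_ne_of_one_lt_card this a

lemma exists_inNeighbour {G : Digraph (Agent n)} (hcard : 2 ≤ nSum n)
    (hG : StronglyConnected G) (a : Agent n) : ∃ b, b ≠ a ∧ G.Adj b a := by
  obtain ⟨q, hq⟩ := exists_ne hcard a
  have key : ∀ x, Relation.ReflTransGen G.Adj x a → x = a ∨ ∃ b, b ≠ a ∧ G.Adj b a := by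
    intro x hx
    induction hx using Relation.ReflTransGen.head_induction_on with
    | refl => exact Or.inl rfl
    | @head x y hxy _ ih =>
      by_cases h : x = a
      · exact Or.inl h
      · refine Or.inr (ih.elim (fun hy => ⟨x, h, hy ▸ hxy⟩) id)
  exact (key q (hG q a)).resolve_left hq

lemma inDeg_pos {G : Digraph (Agent n)} (hcard : 2 ≤ nSum n) (hG : StronglyConnected G)
    (a : Agent n) : 0 < inDeg G a := by
  obtain ⟨b, hb, hba⟩ := exists_inNeighbour hcard hG a
  exact Finset.sum_pos' (fun b _ => adj_nonneg G a b)
    ⟨b, Finset.mem_univ b, by rw [adj_eq_one hba hb]; exact one_pos⟩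

/-- `errMat G` is nonnegative with zero diagonal: each estimate is replaced by a weighted sum of the
estimates of the in-neighbours, with total weight at most one. -/
lemma errMat_mulVec {G : Digraph (Agent n)} (hcard : 2 ≤ nSum n) (hG : StronglyConnected G)
    (z : Agent n × Agent n → ℝ) (a p : Agent n) :
    (errMat G *ᵥ z) (a, p) = 1 / (inDeg G a + adj G a p) * ∑ b, adj G a b * z (b, p) := by
  have hpos : 0 < inDeg G a + adj G a p :=
    add_pos_of_pos_of_nonneg (inDeg_pos hcard hG a) (adj_nonneg G a p)
  rw [errMat, Matrix.sub_mulVec, Matrix.one_mulVec, Pi.sub_apply, estMat_mulVec]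
  simp only [mul_sub, Finset.sum_sub_distrib, ← Finset.sum_mul]
  rw [← inDeg]
  field_simp
  ring

lemma errMat_nonneg {G : Digraph (Agent n)} (hcard : 2 ≤ nSum n) (hG : StronglyConnected G)
    (q r : Agent n × Agent n) : 0 ≤ errMat G q r := by
  have h := errMat_mulVec hcard hG (Pi.single r 1) q.1 q.2
  rw [Matrix.mulVec_single_one] at h
  have e : errMat G q r = _ := h
  rw [e]
  refine mul_nonneg (one_div_nonneg.2 (add_nonneg (inDeg_nonneg G _) (adj_nonneg G _ _)))
    (Finset.sum_nonneg fun b _ => mul_nonneg (adj_nonneg G _ _) ?_)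
  rw [Pi.single_apply]; split_ifs <;> norm_num

/-- The row sums of the powers of `errMat G`. The entry at `(a, p)` is the part of an initial error
of size one that is left in the estimate of the state of `p` held by `a`. -/
noncomputable def rowSumPow (G : Digraph (Agent n)) (k : ℕ) : Agent n × Agent n → ℝ :=
  errMat G ^ k *ᵥ fun _ => 1

lemma rowSumPow_succ {G : Digraph (Agent n)} (hcard : 2 ≤ nSum n) (hG : StronglyConnected G)
    (k : ℕ) (a p : Agent n) : rowSumPow G (k + 1) (a, p) =
      1 / (inDeg G a + adj G a p) * ∑ b, adj G a b * rowSumPow G k (b, p) := by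
  rw [rowSumPow, pow_succ', ← Matrix.mulVec_mulVec, errMat_mulVec hcard hG, rowSumPow]

lemma rowSumPow_nonneg {G : Digraph (Agent n)} (hcard : 2 ≤ nSum n) (hG : StronglyConnected G)
    (k : ℕ) (q : Agent n × Agent n) : 0 ≤ rowSumPow G k q :=
  Finset.sum_nonneg fun r _ =>
    mul_nonneg (pow_entry_nonneg (errMat_nonneg hcard hG) k q r) zero_le_one

lemma rowSumPow_le_one {G : Digraph (Agent n)} (hcard : 2 ≤ nSum n) (hG : StronglyConnected G)
    (k : ℕ) (q : Agent n × Agent n) : rowSumPow G k q ≤ 1 := by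
  obtain ⟨a, p⟩ := q
  induction k generalizing a p with
  | zero => simp [rowSumPow]
  | succ k ih =>
    have hpos : 0 < inDeg G a + adj G a p :=
      add_pos_of_pos_of_nonneg (inDeg_pos hcard hG a) (adj_nonneg G a p)
    rw [rowSumPow_succ hcard hG, one_div, inv_mul_le_iff₀ hpos, mul_one]
    calc ∑ b, adj G a b * rowSumPow G k (b, p) ≤ ∑ b, adj G a b * 1 :=
          Finset.sum_le_sum fun b _ => mul_le_mul_of_nonneg_left (ih b p) (adj_nonneg G a b)
      _ = inDeg G a := by simp [inDeg]
      _ ≤ _ := le_add_of_nonneg_right (adj_nonneg G a p)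

lemma rowSumPow_succ_le {G : Digraph (Agent n)} (hcard : 2 ≤ nSum n) (hG : StronglyConnected G)
    (k : ℕ) (q : Agent n × Agent n) : rowSumPow G (k + 1) q ≤ rowSumPow G k q := by
  rw [rowSumPow, pow_succ, ← Matrix.mulVec_mulVec, rowSumPow]
  refine Finset.sum_le_sum fun r _ => mul_le_mul_of_nonneg_left ?_
    (pow_entry_nonneg (errMat_nonneg hcard hG) k q r)
  simpa [rowSumPow] using rowSumPow_le_one hcard hG 1 r

/-- The loss at `(b, p)` is passed on along every edge from `b` to `a`. -/
lemma rowSumPow_lt_one_of_adj {G : Digraph (Agent n)} (hcard : 2 ≤ nSum n)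
    (hG : StronglyConnected G) {k : ℕ} {a b p : Agent n} (hba : G.Adj b a)
    (h : rowSumPow G k (b, p) < 1) : rowSumPow G (k + 1) (a, p) < 1 := by
  by_cases hne : b = a
  · subst hne
    exact (rowSumPow_succ_le hcard hG k _).trans_lt h
  have hpos : 0 < inDeg G a + adj G a p :=
    add_pos_of_pos_of_nonneg (inDeg_pos hcard hG a) (adj_nonneg G a p)
  rw [rowSumPow_succ hcard hG, one_div, inv_mul_lt_iff₀ hpos, mul_one]
  calc ∑ b, adj G a b * rowSumPow G k (b, p) < ∑ b, adj G a b * 1 := by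
        refine Finset.sum_lt_sum (fun b _ => mul_le_mul_of_nonneg_left
          (rowSumPow_le_one hcard hG k _) (adj_nonneg G a b)) ⟨b, Finset.mem_univ b, ?_⟩
        rw [adj_eq_one hba hne]; linarith
    _ = inDeg G a := by simp [inDeg]
    _ ≤ _ := le_add_of_nonneg_right (adj_nonneg G a p)

lemma exists_rowSumPow_lt_one {G : Digraph (Agent n)} (hcard : 2 ≤ nSum n)
    (hG : StronglyConnected G) (a p : Agent n) : ∃ k, rowSumPow G k (a, p) < 1 := by
  -- The out-neighbours of `p` use the true state of `p`, which makes their row sums less than one.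
  have key : ∀ a, Relation.ReflTransGen G.Adj p a → a = p ∨ ∃ k, rowSumPow G k (a, p) < 1 := by
    intro a ha
    induction ha with
    | refl => exact Or.inl rfl
    | @tail b c _ hbc ih =>
      rcases ih with rfl | ⟨k, hk⟩
      · by_cases hc : c = b
        · exact Or.inl hc
        · right
          refine ⟨1, ?_⟩
          have h1 := adj_eq_one hbc (Ne.symm hc)
          have hpos : 0 < inDeg G c + adj G c b :=
            add_pos_of_pos_of_nonneg (inDeg_pos hcard hG c) (adj_nonneg G c b)
          have h2 := rowSumPow_succ hcard hG 0 c b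
          rw [zero_add] at h2
          rw [h2, one_div, inv_mul_lt_iff₀ hpos, h1]
          simp [rowSumPow, inDeg]
      · exact Or.inr ⟨k + 1, rowSumPow_lt_one_of_adj hcard hG hbc hk⟩
  rcases key a (hG p a) with rfl | h
  · obtain ⟨b, hb, hba⟩ := exists_inNeighbour hcard hG a
    obtain ⟨k, hk⟩ := (key b (hG a b)).resolve_left hb
    exact ⟨k + 1, rowSumPow_lt_one_of_adj hcard hG hba hk⟩
  · exact h

lemma exists_tendsto_errMat {G : Digraph (Agent n)} (hcard : 2 ≤ nSum n)
    (hG : StronglyConnected G) : ∃ m : ℕ, 0 < m ∧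
    Tendsto (fun k : ℕ => (errMat G ^ m) ^ k) atTop (𝓝 0) := by
  have hanti : ∀ q, Antitone fun k => rowSumPow G k q := fun q =>
    antitone_nat_of_succ_le fun k => rowSumPow_succ_le hcard hG k q
  have hev : ∀ q : Agent n × Agent n, ∀ᶠ k in atTop, rowSumPow G k q < 1 := by
    rintro ⟨a, p⟩
    obtain ⟨k, hk⟩ := exists_rowSumPow_lt_one hcard hG a p
    filter_upwards [eventually_ge_atTop k] with j hj
    exact (hanti (a, p) hj).trans_lt hk
  obtain ⟨m, hm0, hm⟩ := ((eventually_gt_atTop 0).and (eventually_all.2 hev)).exists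
  have : Nonempty (Agent n × Agent n) := by
    have : 0 < Fintype.card (Agent n) := by simpa [nSum] using (by omega : 0 < nSum n)
    have := Fintype.card_pos_iff.1 this
    infer_instance
  obtain ⟨q₀, hq₀⟩ := Finite.exists_max fun q => rowSumPow G m q
  refine ⟨m, hm0, tendsto_pow_zero_of_rowSum_le (pow_entry_nonneg (errMat_nonneg hcard hG) m)
    (c := rowSumPow G m q₀) (rowSumPow_nonneg hcard hG m q₀) (hm q₀) fun q => ?_⟩
  simpa [rowSumPow, Matrix.mulVec, dotProduct] using hq₀ q

lemma IsRowWeights.isErgodic {G : Digraph (Agent n)} {R : ∀ i, Matrix (Fin (n i)) (Fin (n i)) ℝ}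
    (hR : IsRowWeights G R) {i : Fin N} (hGi : StronglyConnected (coalitionGraph G i)) :
    IsErgodic (R i) where
  nonneg j m := by
    by_cases h : m = j ∨ (coalitionGraph G i).Adj m j
    · exact ((hR i j).1 m h).le
    · exact ((hR i j).2.1 m h).ge
  rowSum j := (hR i j).2.2
  diag_pos j := (hR i j).1 j (Or.inl rfl)
  connected j m := by
    have h := hGi m j
    rw [← Relation.reflTransGen_swap] at h
    exact Relation.ReflTransGen.mono (fun a b hab => (hR i a).1 b (Or.inr hab)) _ _ h

lemma IsColWeights.isErgodic {G : Digraph (Agent n)} {C : ∀ i, Matrix (Fin (n i)) (Fin (n i)) ℝ}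
    (hC : IsColWeights G C) {i : Fin N} (hGi : StronglyConnected (coalitionGraph G i)) :
    IsErgodic (C i)ᵀ where
  nonneg j m := by
    by_cases h : m = j ∨ (coalitionGraph G i).Adj j m
    · exact ((hC i j).1 m h).le
    · exact ((hC i j).2.1 m h).ge
  rowSum j := (hC i j).2.2
  diag_pos j := (hC i j).1 j (Or.inl rfl)
  connected j m := Relation.ReflTransGen.mono (fun a b hab => (hC i a).1 b (Or.inr hab)) _ _ (hGi j m)

lemma rightProj_eq_transpose {m : ℕ} (v : Fin m → ℝ) :
    rightProj v = (leftProj v)ᵀ := by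
  ext i j
  simp [rightProj, leftProj, Matrix.vecMulVec_apply]

lemma exists_spectral {G : Digraph (Agent n)} (hn : ∀ i, 0 < n i) (hcard : 2 ≤ nSum n)
    (hG : StronglyConnected G) (hGi : ∀ i, StronglyConnected (coalitionGraph G i))
    {R C : ∀ i, Matrix (Fin (n i)) (Fin (n i)) ℝ}
    (hR : IsRowWeights G R) (hC : IsColWeights G C) : ∃ S : Spectral n, S.IsFor G R C := by
  have hne : ∀ i, Nonempty (Fin (n i)) := fun i => ⟨⟨0, hn i⟩⟩
  have hn0 : ∀ i, (n i : ℝ) ≠ 0 := fun i => by exact_mod_cast (hn i).ne'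
  have hu : ∀ i, ∃ u : Fin (n i) → ℝ, u ᵥ* R i = u ∧ ∑ j, u j = n i := fun i =>
    (hR.isErgodic (hGi i)).exists_fixed _
  have hv : ∀ i, ∃ v : Fin (n i) → ℝ, v ᵥ* (C i)ᵀ = v ∧ ∑ j, v j = n i := fun i =>
    (hC.isErgodic (hGi i)).exists_fixed _
  choose u hu1 hu2 using hu
  choose v hv1 hv2 using hv
  have hWR : ∀ i, ∃ W, IsLyapunovMatrix (R i - leftProj (u i)) W := fun i => by
    obtain ⟨m, hm, ht⟩ :=
      (hR.isErgodic (hGi i)).exists_tendsto_sub_limit (hn0 i) (hu1 i) (hu2 i)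
    exact exists_isLyapunovMatrix hm ht
  have hWc : ∀ i, ∃ W, IsLyapunovMatrix (C i - rightProj (v i)) W := fun i => by
    obtain ⟨m, hm, ht⟩ :=
      (hC.isErgodic (hGi i)).exists_tendsto_sub_limit (hn0 i) (hv1 i) (hv2 i)
    refine exists_isLyapunovMatrix hm ?_
    have h1 := (continuous_id.matrix_transpose.tendsto (0 : Matrix (Fin (n i)) (Fin (n i)) ℝ)).comp
      ht
    rw [id, Matrix.transpose_zero] at h1
    refine h1.congr fun k => ?_
    rw [Function.comp_apply, id, Matrix.transpose_pow, Matrix.transpose_pow, Matrix.transpose_sub,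
      Matrix.transpose_transpose, rightProj_eq_transpose]
    rfl
  obtain ⟨m, hm, ht⟩ := exists_tendsto_errMat hcard hG
  obtain ⟨WM, hWM⟩ := exists_isLyapunovMatrix hm ht
  choose WR hWR using hWR
  choose Wc hWc using hWc
  exact ⟨⟨u, v, Wc, WR, WM⟩, hu1, hu2, fun i => by rw [← Matrix.vecMul_transpose]; exact hv1 i, hv2,
    hWc, hWR, hWM⟩

lemma Spectral.IsFor.u_pos {G : Digraph (Agent n)} {R C : ∀ i, Matrix (Fin (n i)) (Fin (n i)) ℝ}
    {S : Spectral n} (hS : S.IsFor G R C) (hR : IsRowWeights G R) {i : Fin N} (hn : 0 < n i)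
    (hGi : StronglyConnected (coalitionGraph G i)) (j : Fin (n i)) : 0 < S.u i j :=
  (hR.isErgodic hGi).fixed_pos (hS.u_eigen i) (by rw [hS.u_sum]; exact_mod_cast hn) j

lemma Spectral.IsFor.v_pos {G : Digraph (Agent n)} {R C : ∀ i, Matrix (Fin (n i)) (Fin (n i)) ℝ}
    {S : Spectral n} (hS : S.IsFor G R C) (hC : IsColWeights G C) {i : Fin N} (hn : 0 < n i)
    (hGi : StronglyConnected (coalitionGraph G i)) (j : Fin (n i)) : 0 < S.v i j :=
  (hC.isErgodic hGi).fixed_pos (by rw [Matrix.vecMul_transpose]; exact hS.v_eigen i)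
    (by rw [hS.v_sum]; exact_mod_cast hn) j

lemma Spectral.IsFor.dotProduct_pos {G : Digraph (Agent n)}
    {R C : ∀ i, Matrix (Fin (n i)) (Fin (n i)) ℝ} {S : Spectral n} (hS : S.IsFor G R C)
    (hR : IsRowWeights G R) (hC : IsColWeights G C) {i : Fin N} (hn : 0 < n i)
    (hGi : StronglyConnected (coalitionGraph G i)) : 0 < S.u i ⬝ᵥ S.v i :=
  Finset.sum_pos (fun j _ => mul_pos (hS.u_pos hR hn hGi j) (hS.v_pos hC hn hGi j))
    ⟨⟨0, hn⟩, Finset.mem_univ _⟩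

end Network

/-! ### Equilibria -/

section Equilibrium

lemma exists_zero_of_strongly_monotone {E : Type*} [NormedAddCommGroup E] [InnerProductSpace ℝ E]
    [CompleteSpace E] {Q : E → E} {K l : ℝ} (hl : 0 < l) (hK : 0 ≤ K)
    (hlip : ∀ a b, ‖Q a - Q b‖ ≤ K * ‖a - b‖)
    (hmono : ∀ a b, l * ‖a - b‖ ^ 2 ≤ inner ℝ (a - b) (Q a - Q b)) : ∃ y, Q y = 0 := by
  -- `y ↦ y - (l / L²) Q y` is a contraction for every Lipschitz constant `L ≥ l` of `Q`.
  set L := K + l with hL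
  have hL0 : 0 < L := by positivity
  have hlL : l ^ 2 / L ^ 2 ≤ 1 := by
    rw [div_le_one (by positivity)]
    exact pow_le_pow_left₀ hl.le (by linarith) 2
  set t := l / L ^ 2 with ht
  have ht0 : 0 < t := by positivity
  set c : NNReal := (√(1 - l ^ 2 / L ^ 2)).toNNReal with hc
  have hcon : ContractingWith c (fun y => y - t • Q y) := by
    refine ⟨?_, LipschitzWith.of_dist_le_mul fun a b => ?_⟩
    · rw [← NNReal.coe_lt_coe, hc, Real.coe_toNNReal _ (Real.sqrt_nonneg _), NNReal.coe_one, Real.sqrt_lt' one_pos]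
      have : 0 < l ^ 2 / L ^ 2 := by positivity
      linarith
    · rw [dist_eq_norm, dist_eq_norm]
      refine abs_le_of_sq_le_sq' ?_ (by positivity) |>.2
      rw [mul_pow, hc, Real.coe_toNNReal _ (Real.sqrt_nonneg _), Real.sq_sqrt (by linarith)]
      have e : a - t • Q a - (b - t • Q b) = (a - b) - t • (Q a - Q b) := by
        rw [smul_sub]; abel
      rw [e, norm_sub_sq_real, inner_smul_right, norm_smul, Real.norm_eq_abs, abs_of_pos ht0]
      have h1 := hmono a b
      have h2 : ‖Q a - Q b‖ ^ 2 ≤ L ^ 2 * ‖a - b‖ ^ 2 := by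
        rw [← mul_pow]
        refine pow_le_pow_left₀ (norm_nonneg _) ((hlip a b).trans ?_) 2
        exact mul_le_mul_of_nonneg_right (by linarith) (norm_nonneg _)
      have h3 : t * (l * ‖a - b‖ ^ 2) ≤ t * inner ℝ (a - b) (Q a - Q b) :=
        mul_le_mul_of_nonneg_left h1 ht0.le
      have h4 : t ^ 2 * ‖Q a - Q b‖ ^ 2 ≤ t ^ 2 * (L ^ 2 * ‖a - b‖ ^ 2) :=
        mul_le_mul_of_nonneg_left h2 (by positivity)
      have h5 : t ^ 2 * (L ^ 2 * ‖a - b‖ ^ 2) = l ^ 2 / L ^ 2 * ‖a - b‖ ^ 2 := by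
        rw [ht]; field_simp
      have h6 : t * (l * ‖a - b‖ ^ 2) = l ^ 2 / L ^ 2 * ‖a - b‖ ^ 2 := by
        rw [ht]; field_simp
      rw [mul_pow]
      nlinarith
  refine ⟨hcon.fixedPoint, ?_⟩
  have h : _ - t • Q hcon.fixedPoint = _ := hcon.fixedPoint_isFixedPt
  rw [sub_eq_self] at h
  exact (smul_eq_zero.1 h).resolve_left ht0.ne'

variable {N : ℕ} {n : Fin N → ℕ}

/-- `spread n` as a continuous linear map. -/
noncomputable def spreadCLM (n : Fin N → ℕ) : EuclideanSpace ℝ (Fin N) →L[ℝ] State n :=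
  LinearMap.toContinuousLinearMap
    { toFun := spread n
      map_add' := fun _ _ => rfl
      map_smul' := fun _ _ => rfl }

lemma spreadCLM_apply (y : EuclideanSpace ℝ (Fin N)) : spreadCLM n y = spread n y := rfl

/-- The derivative of the cost of agent `a` in the direction in which all agents of its coalition
move together. -/
noncomputable def agentSlope (f : Agent n → State n → ℝ) (a : Agent n) (z : State n) : ℝ :=
  ∑ l : Fin (n a.1), gradient (f a) z ⟨a.1, l⟩

lemma fderiv_spread_single {f : Agent n → State n → ℝ} {a : Agent n} (z : State n) :
    fderiv ℝ (f a) z (spread n (EuclideanSpace.single a.1 1)) = agentSlope f a z := by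
  rw [← inner_gradient_left, agentSlope, PiLp.inner_apply, Fintype.sum_sigma,
    Finset.sum_eq_single a.1]
  · simp [spread]
  · intro i _ hi
    simp [spread, hi]
  · simp

lemma hasFDerivAt_virtualCost {f : Agent n → State n → ℝ} (hC2 : ∀ a, ContDiff ℝ 2 (f a))
    (i : Fin N) (y : EuclideanSpace ℝ (Fin N)) :
    HasFDerivAt (virtualCost f i)
      (∑ j : Fin (n i), (fderiv ℝ (f ⟨i, j⟩) (spread n y)).comp (spreadCLM n)) y := by
  have h : ∀ j : Fin (n i), HasFDerivAt (fun y => f ⟨i, j⟩ (spreadCLM n y))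
      ((fderiv ℝ (f ⟨i, j⟩) (spread n y)).comp (spreadCLM n)) y := fun j =>
    (((hC2 ⟨i, j⟩).differentiable (by norm_num)) _).hasFDerivAt.comp y (spreadCLM n).hasFDerivAt
  exact HasFDerivAt.fun_sum (u := Finset.univ) fun j _ => h j

lemma pseudoGradient_apply {f : Agent n → State n → ℝ} (hC2 : ∀ a, ContDiff ℝ 2 (f a))
    (y : EuclideanSpace ℝ (Fin N)) (i : Fin N) :
    pseudoGradient f y i = ∑ j : Fin (n i), agentSlope f ⟨i, j⟩ (spread n y) := by
  have h : inner ℝ (gradient (virtualCost f i) y) (EuclideanSpace.single i 1) =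
      gradient (virtualCost f i) y i := by
    rw [EuclideanSpace.inner_single_right]; simp
  show gradient (virtualCost f i) y i = _
  rw [← h, inner_gradient_left, (hasFDerivAt_virtualCost hC2 i y).fderiv,
    sum_apply]
  refine Finset.sum_congr rfl fun j _ => ?_
  rw [ContinuousLinearMap.comp_apply, spreadCLM_apply, ← fderiv_spread_single]

lemma hasDerivAt_virtualCost_line {f : Agent n → State n → ℝ} (hC2 : ∀ a, ContDiff ℝ 2 (f a))
    (i : Fin N) (y : EuclideanSpace ℝ (Fin N)) :
    HasDerivAt (fun t : ℝ => virtualCost f i (y + t • EuclideanSpace.single i 1))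
      (pseudoGradient f y i) 0 := by
  have h1 : HasDerivAt (fun t : ℝ => y + t • EuclideanSpace.single i (1 : ℝ))
      (EuclideanSpace.single i 1) 0 := by
    have h := ((hasDerivAt_id (0 : ℝ)).smul_const
      (EuclideanSpace.single i 1 : EuclideanSpace ℝ (Fin N))).const_add y
    simpa using h
  have h2 := hasFDerivAt_virtualCost hC2 i
    (y + (0 : ℝ) • (EuclideanSpace.single i 1 : EuclideanSpace ℝ (Fin N)))
  refine (h2.comp_hasDerivAt (0 : ℝ) h1).congr_deriv ?_
  rw [pseudoGradient_apply hC2, sum_apply, zero_smul, add_zero]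
  refine Finset.sum_congr rfl fun j _ => ?_
  rw [ContinuousLinearMap.comp_apply, spreadCLM_apply, ← fderiv_spread_single]

lemma convexOn_virtualCost_line {f : Agent n → State n → ℝ}
    (hconv : ∀ a, ConvexOn ℝ Set.univ (f a)) (i : Fin N) (y : EuclideanSpace ℝ (Fin N)) :
    ConvexOn ℝ Set.univ
      (fun t : ℝ => virtualCost f i (y + t • EuclideanSpace.single i 1)) := by
  have h : ConvexOn ℝ Set.univ (coalitionCost f i) := by
    have e : coalitionCost f i = ∑ j : Fin (n i), f ⟨i, j⟩ := by
      ext x; simp [coalitionCost]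
    rw [e]
    refine Finset.sum_induction _ (ConvexOn ℝ Set.univ) (fun _ _ h1 h2 => h1.add h2)
      (convexOn_const 0 convex_univ) fun j _ => hconv _
  have h2 := h.comp_affineMap ((spreadCLM n).toLinearMap.toAffineMap.comp
    (AffineMap.lineMap y (y + EuclideanSpace.single i (1 : ℝ))))
  simp only [Set.preimage_univ] at h2
  refine h2.congr fun t _ => ?_
  simp [virtualCost, AffineMap.lineMap_apply, ← spreadCLM_apply, add_comm]

lemma spread_line (y : EuclideanSpace ℝ (Fin N)) (i : Fin N) (t : ℝ) (a : Agent n) :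
    spread n (y + t • EuclideanSpace.single i 1) a = y a.1 + if a.1 = i then t else 0 := by
  simp [spread]

/-- The equilibria are the consensus states at which the pseudo-gradient vanishes. -/
lemma isNashEquilibrium_iff {f : Agent n → State n → ℝ}
    (hconv : ∀ a, ConvexOn ℝ Set.univ (f a)) (hC2 : ∀ a, ContDiff ℝ 2 (f a)) (x : State n) :
    IsNashEquilibrium f x ↔ ∃ y, x = spread n y ∧ pseudoGradient f y = 0 := by
  constructor
  · rintro ⟨hx, hmin⟩
    choose θ hθ using hx
    have hxy : x = spread n (WithLp.toLp 2 θ) := by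
      ext ⟨i, j⟩; exact hθ i j
    refine ⟨WithLp.toLp 2 θ, hxy, ?_⟩
    ext i
    refine IsLocalMin.hasDerivAt_eq_zero (Filter.Eventually.of_forall fun t => ?_)
      (hasDerivAt_virtualCost_line hC2 i (WithLp.toLp 2 θ))
    have h := hmin i (spread n (WithLp.toLp 2 θ + t • EuclideanSpace.single i 1)) ?_
      ⟨θ i + t, fun j => ?_⟩
    · rw [hxy] at h
      simpa [virtualCost] using h
    · intro a ha
      rw [spread_line, if_neg ha, hxy]; simp [spread]
    · rw [spread_line]; simp
  · rintro ⟨y, rfl, hy⟩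
    refine ⟨fun i => ⟨y i, fun j => rfl⟩, fun i z hz ⟨θ, hθ⟩ => ?_⟩
    have hz' : z = spread n (y + (θ - y i) • EuclideanSpace.single i 1) := by
      ext ⟨p, j⟩
      rw [spread_line]
      by_cases hp : p = i
      · subst hp; simp [hθ j]
      · simp [hp, hz ⟨p, j⟩ hp, spread]
    have hd := hasDerivAt_virtualCost_line hC2 i y
    rw [hy] at hd
    have hm := (convexOn_virtualCost_line hconv i y).isMinOn_of_rightDeriv_eq_zero
      (x := 0) (by simp) (hd.hasDerivWithinAt.derivWithin (uniqueDiffWithinAt_Ioi 0))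
    have := hm (Set.mem_univ (θ - y i))
    rw [hz']
    simpa [virtualCost] using this

lemma agentSlope_sub_sq_le {f : Agent n → State n → ℝ} {lip : Agent n → ℝ}
    (hlip : ∀ a x y, ‖gradient (f a) x - gradient (f a) y‖ ≤ lip a * ‖x - y‖) (a : Agent n)
    (x y : State n) :
    (agentSlope f a x - agentSlope f a y) ^ 2 ≤ n a.1 * (lip a ^ 2 * ‖x - y‖ ^ 2) := by
  set d := gradient (f a) x - gradient (f a) y with hd
  have e : agentSlope f a x - agentSlope f a y = ∑ l : Fin (n a.1), d ⟨a.1, l⟩ := by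
    simp [agentSlope, hd, Finset.sum_sub_distrib]
  have h1 := sq_sum_le_card_mul_sum_sq (s := Finset.univ) (f := fun l : Fin (n a.1) => d ⟨a.1, l⟩)
  have h2 : ∑ l : Fin (n a.1), d ⟨a.1, l⟩ ^ 2 ≤ ‖d‖ ^ 2 := by
    rw [EuclideanSpace.real_norm_sq_eq, Fintype.sum_sigma]
    exact Finset.single_le_sum (f := fun i => ∑ l : Fin (n i), d ⟨i, l⟩ ^ 2)
      (fun i _ => Finset.sum_nonneg fun l _ => sq_nonneg _) (Finset.mem_univ a.1)
  have h3 : ‖d‖ ^ 2 ≤ lip a ^ 2 * ‖x - y‖ ^ 2 := by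
    rw [← mul_pow]
    exact pow_le_pow_left₀ (norm_nonneg _) (hlip a x y) 2
  rw [e]
  rw [Finset.card_univ, Fintype.card_fin] at h1
  exact h1.trans (mul_le_mul_of_nonneg_left (h2.trans h3) (Nat.cast_nonneg _))

lemma exists_lipschitz_pseudoGradient {f : Agent n → State n → ℝ} {lip : Agent n → ℝ}
    (hC2 : ∀ a, ContDiff ℝ 2 (f a))
    (hlip : ∀ a x y, ‖gradient (f a) x - gradient (f a) y‖ ≤ lip a * ‖x - y‖) :
    ∃ K, 0 ≤ K ∧ ∀ y z, ‖pseudoGradient f y - pseudoGradient f z‖ ≤ K * ‖y - z‖ := by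
  refine ⟨√(∑ i, n i * ∑ j : Fin (n i), n i * (lip ⟨i, j⟩ ^ 2 * ‖spreadCLM n‖ ^ 2)),
    Real.sqrt_nonneg _, fun y z => ?_⟩
  have hs : ‖spread n y - spread n z‖ ^ 2 ≤ ‖spreadCLM n‖ ^ 2 * ‖y - z‖ ^ 2 := by
    rw [← mul_pow, ← spreadCLM_apply, ← spreadCLM_apply, ← map_sub]
    exact pow_le_pow_left₀ (norm_nonneg _) ((spreadCLM n).le_opNorm _) 2
  refine abs_le_of_sq_le_sq' ?_ (by positivity) |>.2
  rw [mul_pow, Real.sq_sqrt (Finset.sum_nonneg fun i _ => by positivity),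
    EuclideanSpace.real_norm_sq_eq, Finset.sum_mul]
  refine Finset.sum_le_sum fun i _ => ?_
  rw [PiLp.sub_apply, pseudoGradient_apply hC2, pseudoGradient_apply hC2,
    ← Finset.sum_sub_distrib]
  refine (sq_sum_le_card_mul_sum_sq).trans ?_
  rw [Finset.card_univ, Fintype.card_fin, mul_assoc, Finset.sum_mul]
  refine mul_le_mul_of_nonneg_left (Finset.sum_le_sum fun j _ => ?_) (Nat.cast_nonneg _)
  refine (agentSlope_sub_sq_le hlip ⟨i, j⟩ _ _).trans ?_
  rw [mul_assoc, mul_assoc]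
  exact mul_le_mul_of_nonneg_left (mul_le_mul_of_nonneg_left hs (sq_nonneg _)) (Nat.cast_nonneg _)

lemma existsUnique_isNashEquilibrium {f : Agent n → State n → ℝ} {lip : Agent n → ℝ} {l : ℝ}
    (hconv : ∀ a, ConvexOn ℝ Set.univ (f a)) (hC2 : ∀ a, ContDiff ℝ 2 (f a))
    (hlip : ∀ a x y, ‖gradient (f a) x - gradient (f a) y‖ ≤ lip a * ‖x - y‖) (hl : 0 < l)
    (hmono : ∀ a b : EuclideanSpace ℝ (Fin N),
      l * ‖a - b‖ ^ 2 ≤ inner ℝ (a - b) (pseudoGradient f a - pseudoGradient f b)) :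
    ∃! x, IsNashEquilibrium f x := by
  obtain ⟨K, hK0, hK⟩ := exists_lipschitz_pseudoGradient hC2 hlip
  obtain ⟨y, hy⟩ := exists_zero_of_strongly_monotone hl hK0 hK hmono
  refine ⟨spread n y, (isNashEquilibrium_iff hconv hC2 _).2 ⟨y, rfl, hy⟩, fun x hx => ?_⟩
  obtain ⟨z, rfl, hz⟩ := (isNashEquilibrium_iff hconv hC2 _).1 hx
  have h := hmono z y
  rw [hz, hy, sub_self, inner_zero_right] at h
  have h2 : ‖z - y‖ ^ 2 = 0 := le_antisymm (by nlinarith) (sq_nonneg _)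
  rw [sub_eq_zero.1 (norm_eq_zero.1 (pow_eq_zero_iff two_ne_zero |>.1 h2))]

end Equilibrium

/-! ### Errors and their recursions -/

section Errors

variable {N : ℕ} {n : Fin N → ℕ}

/-- The averages of the states of the coalitions with weights `u i / n i`. -/
noncomputable def avgState (S : Spectral n) (x : State n) : EuclideanSpace ℝ (Fin N) :=
  WithLp.toLp 2 fun i => (S.u i ⬝ᵥ fun j => x ⟨i, j⟩) / n i

/-- The deviation of the states of coalition `i` from their weighted average. -/
noncomputable def disagreement (S : Spectral n) (x : State n) (i : Fin N) : Fin (n i) → ℝ :=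
  (1 - leftProj (S.u i)) *ᵥ fun j => x ⟨i, j⟩

/-- The search directions of coalition `i`: the entry `j` is the sum of the trackers held by agent
`j`. The states depend on the trackers through these sums only. -/
def trackSum (s : Vars n) (i : Fin N) : Fin (n i) → ℝ := fun j => ∑ m, s.ψ i j m

/-- The deviation of the search directions from their share in the total, given by `v i / n i`. -/
noncomputable def trackErr (S : Spectral n) (s : Vars n) (i : Fin N) : Fin (n i) → ℝ :=
  (1 - rightProj (S.v i)) *ᵥ trackSum s i

/-- The errors of the estimates as estimates of the weighted averages. -/
noncomputable def estErr (S : Spectral n) (s : Vars n) : Agent n × Agent n → ℝ :=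
  fun q => s.ξ q.1 q.2 - avgState S s.x q.2.1

/-- The part of the squared estimation error that is due to the agents of coalition `i`. -/
noncomputable def estErrSq (S : Spectral n) (s : Vars n) (i : Fin N) : ℝ :=
  ∑ j : Fin (n i), ∑ p, estErr S s (⟨i, j⟩, p) ^ 2

/-- In each coalition the search directions add up to the sum of the slopes at the estimates. -/
def IsTracking (f : Agent n → State n → ℝ) (s : Vars n) : Prop :=
  ∀ i, ∑ j, trackSum s i j = ∑ j : Fin (n i), agentSlope f ⟨i, j⟩ (s.ξ ⟨i, j⟩)

/-- A vector indexed by agents, seen as a family of identical estimates held by all agents. -/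
def lift (w : Agent n → ℝ) : Agent n × Agent n → ℝ := fun q => w q.2

lemma lift_dotProduct_self (w : Agent n → ℝ) :
    lift w ⬝ᵥ lift w = nSum n * ∑ i, ∑ j : Fin (n i), w ⟨i, j⟩ ^ 2 := by
  simp only [dotProduct, lift, Fintype.sum_prod_type, Finset.sum_const, Finset.card_univ,
    nsmul_eq_mul, ← sq, Fintype.card_sigma, Fintype.card_fin, nSum]
  rw [Fintype.sum_sigma]

lemma leftProj_mulVec {m : ℕ} (u w : Fin m → ℝ) :
    leftProj u *ᵥ w = fun _ => (u ⬝ᵥ w) / m := by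
  ext j
  simp [leftProj, Matrix.smul_mulVec, Matrix.vecMulVec_mulVec, div_eq_inv_mul]

lemma rightProj_mulVec {m : ℕ} (v w : Fin m → ℝ) :
    rightProj v *ᵥ w = ((∑ j, w j) / m) • v := by
  ext j
  simp [rightProj, Matrix.smul_mulVec, Matrix.vecMulVec_mulVec, div_eq_inv_mul, dotProduct]
  ring

lemma disagreement_apply (S : Spectral n) (x : State n) (i : Fin N) (j : Fin (n i)) :
    disagreement S x i j = x ⟨i, j⟩ - avgState S x i := by
  rw [disagreement, Matrix.sub_mulVec, leftProj_mulVec, Matrix.one_mulVec]; rfl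

lemma trackSum_eq (S : Spectral n) (s : Vars n) (i : Fin N) :
    trackSum s i = trackErr S s i + ((∑ j, trackSum s i j) / n i) • S.v i := by
  rw [trackErr, Matrix.sub_mulVec, rightProj_mulVec, Matrix.one_mulVec, sub_add_cancel]

lemma estErr_dotProduct_self (S : Spectral n) (s : Vars n) :
    estErr S s ⬝ᵥ estErr S s = ∑ i, estErrSq S s i := by
  simp only [dotProduct, Fintype.sum_prod_type, estErrSq, ← sq]
  rw [Fintype.sum_sigma]

lemma norm_sub_spread_avg_sq (S : Spectral n) (s : Vars n) (a : Agent n) :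
    ‖s.ξ a - spread n (avgState S s.x)‖ ^ 2 = ∑ p, estErr S s (a, p) ^ 2 := by
  rw [EuclideanSpace.real_norm_sq_eq]
  rfl

lemma norm_spread_sq (y : EuclideanSpace ℝ (Fin N)) :
    ‖spread n y‖ ^ 2 = ∑ i, n i * y i ^ 2 := by
  rw [EuclideanSpace.real_norm_sq_eq, Fintype.sum_sigma]
  simp [spread]

lemma norm_spread_sq_le (y : EuclideanSpace ℝ (Fin N)) :
    ‖spread n y‖ ^ 2 ≤ (⨆ p : Fin N, (n p : ℝ)) * ‖y‖ ^ 2 := by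
  rw [norm_spread_sq, EuclideanSpace.real_norm_sq_eq, Finset.mul_sum]
  exact Finset.sum_le_sum fun i _ => mul_le_mul_of_nonneg_right
    (le_ciSup (f := fun p : Fin N => (n p : ℝ)) (Set.finite_range _).bddAbove i) (sq_nonneg _)

/-- If `L` is a projection fixed by `A` on both sides, then the projection `1 - L` turns the
iteration with `A` into the iteration with `A - L`. -/
lemma mulVec_sub_fixed {ι : Type*} [Fintype ι] [DecidableEq ι] {A L : Matrix ι ι ℝ}
    (h1 : A * L = L) (h2 : L * A = L) (h3 : L * L = L) (x d : ι → ℝ) :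
    (1 - L) *ᵥ (A *ᵥ x + d) = (A - L) *ᵥ ((1 - L) *ᵥ x) + (1 - L) *ᵥ d := by
  have e1 : (1 - L) * A = A - L := by rw [sub_mul, one_mul, h2]
  have e2 : (A - L) * (1 - L) = A - L := by
    rw [mul_sub, mul_one, sub_mul, h1, h3, sub_self, sub_zero]
  rw [Matrix.mulVec_add, Matrix.mulVec_mulVec, Matrix.mulVec_mulVec, e1, e2]

section Step

variable {G : Digraph (Agent n)} {R C : ∀ i, Matrix (Fin (n i)) (Fin (n i)) ℝ}
  {f : Agent n → State n → ℝ} {S : Spectral n} {α : ℝ}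

lemma nextVars_x_block (s : Vars n) (i : Fin N) :
    (fun j => (nextVars G R C f α s).x ⟨i, j⟩) =
      R i *ᵥ (fun j => s.x ⟨i, j⟩) + -(α / n i) • trackSum s i := by
  ext j
  simp [nextVars, Matrix.mulVec, dotProduct, trackSum, sub_eq_add_neg]

lemma avgState_nextVars (hS : S.IsFor G R C) (s : Vars n) (i : Fin N) :
    avgState S (nextVars G R C f α s).x i =
      avgState S s.x i - α / n i ^ 2 * (S.u i ⬝ᵥ trackSum s i) := by
  simp only [avgState]
  rw [nextVars_x_block, dotProduct_add, Matrix.dotProduct_mulVec, hS.u_eigen, dotProduct_smul,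
    smul_eq_mul]
  by_cases h : (n i : ℝ) = 0
  · simp [h]
  · field_simp
    ring

lemma trackSum_nextVars (s : Vars n) (i : Fin N) :
    trackSum (nextVars G R C f α s) i = C i *ᵥ trackSum s i +
      fun j => agentSlope f ⟨i, j⟩ ((nextVars G R C f α s).ξ ⟨i, j⟩) -
        agentSlope f ⟨i, j⟩ (s.ξ ⟨i, j⟩) := by
  ext j
  simp only [trackSum, nextVars, Finset.sum_sub_distrib, Finset.sum_add_distrib, Pi.add_apply,
    Matrix.mulVec, dotProduct, agentSlope, trackedGrad, add_sub_assoc]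
  congr 1
  rw [Finset.sum_comm]
  simp only [Finset.mul_sum]

lemma isTracking_initVars (x₀ : State n) (ξ₀ : Agent n → State n) :
    IsTracking f (initVars f x₀ ξ₀) := fun _ => rfl

lemma IsTracking.nextVars (hC : IsColWeights G C) {s : Vars n} (h : IsTracking f s) :
    IsTracking f (nextVars G R C f α s) := by
  intro i
  rw [trackSum_nextVars]
  simp only [Pi.add_apply, Finset.sum_add_distrib, Finset.sum_sub_distrib]
  have e : ∑ j, (C i *ᵥ trackSum s i) j = ∑ j, trackSum s i j := by
    simp only [Matrix.mulVec, dotProduct]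
    rw [Finset.sum_comm]
    simp only [← Finset.sum_mul, (hC i _).2.2, one_mul]
  rw [e, h i]
  ring

lemma isTracking_run (hC : IsColWeights G C) (x₀ : State n) (ξ₀ : Agent n → State n) (k : ℕ) :
    IsTracking f (run G R C f α x₀ ξ₀ k) := by
  induction k with
  | zero => exact isTracking_initVars x₀ ξ₀
  | succ k ih => exact ih.nextVars hC

lemma disagreement_nextVars (hn : ∀ i, 0 < n i) (hS : S.IsFor G R C) (hR : IsRowWeights G R)
    (s : Vars n) (i : Fin N) :
    disagreement S (nextVars G R C f α s).x i =
      (R i - leftProj (S.u i)) *ᵥ disagreement S s.x i +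
        (1 - leftProj (S.u i)) *ᵥ (-(α / n i) • trackSum s i) := by
  have hn0 : (n i : ℝ) ≠ 0 := by exact_mod_cast (hn i).ne'
  have hR1 : R i *ᵥ (fun _ => (1 : ℝ)) = fun _ => 1 := by
    ext j; simpa [Matrix.mulVec, dotProduct] using (hR i j).2.2
  rw [disagreement, nextVars_x_block, disagreement]
  refine mulVec_sub_fixed ?_ ?_ ?_ _ _
  · rw [leftProj, Matrix.mul_smul, Matrix.mul_vecMulVec, hR1]
  · rw [leftProj, Matrix.smul_mul, Matrix.vecMulVec_mul, hS.u_eigen]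
  · nth_rw 2 [leftProj]
    rw [Matrix.mul_smul, Matrix.mul_vecMulVec, leftProj_mulVec, leftProj]
    congr 2
    ext j
    have : (S.u i ⬝ᵥ fun _ => (1 : ℝ)) = n i := by simpa [dotProduct] using hS.u_sum i
    rw [this, div_self hn0]

lemma trackErr_nextVars (hn : ∀ i, 0 < n i) (hS : S.IsFor G R C) (hC : IsColWeights G C)
    (s : Vars n) (i : Fin N) :
    trackErr S (nextVars G R C f α s) i =
      (C i - rightProj (S.v i)) *ᵥ trackErr S s i +
        (1 - rightProj (S.v i)) *ᵥ
          fun j => agentSlope f ⟨i, j⟩ ((nextVars G R C f α s).ξ ⟨i, j⟩) -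
            agentSlope f ⟨i, j⟩ (s.ξ ⟨i, j⟩) := by
  have hn0 : (n i : ℝ) ≠ 0 := by exact_mod_cast (hn i).ne'
  have hC1 : (fun _ => (1 : ℝ)) ᵥ* C i = fun _ => 1 := by
    ext j; simpa [Matrix.vecMul, dotProduct] using (hC i j).2.2
  rw [trackErr, trackSum_nextVars, trackErr]
  refine mulVec_sub_fixed ?_ ?_ ?_ _ _
  · rw [rightProj, Matrix.mul_smul, Matrix.mul_vecMulVec, hS.v_eigen]
  · rw [rightProj, Matrix.smul_mul, Matrix.vecMulVec_mul, hC1]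
  · nth_rw 2 [rightProj]
    rw [Matrix.mul_smul, Matrix.mul_vecMulVec, rightProj_mulVec, hS.v_sum, div_self hn0, one_smul,
      rightProj]

lemma sub_eq_estErr_sub_lift (s : Vars n) :
    (fun q : Agent n × Agent n => s.ξ q.1 q.2 - s.x q.2) =
      estErr S s - lift fun a => disagreement S s.x a.1 a.2 := by
  ext q
  simp [estErr, lift, disagreement_apply]

lemma estErr_nextVars (s : Vars n) :
    estErr S (nextVars G R C f α s) = errMat G *ᵥ estErr S s +
      (1 : Matrix (Agent n × Agent n) (Agent n × Agent n) ℝ) *ᵥ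
        (estMat G *ᵥ (lift fun a => disagreement S s.x a.1 a.2) -
          lift fun a => avgState S (nextVars G R C f α s).x a.1 - avgState S s.x a.1) := by
  ext ⟨a, p⟩
  have h := nextξ_apply G s a p
  rw [sub_eq_estErr_sub_lift (S := S), Matrix.mulVec_sub, Pi.sub_apply] at h
  have e : (nextVars G R C f α s).ξ a p = nextξ G s a p := rfl
  rw [errMat, Matrix.sub_mulVec, Matrix.one_mulVec, Matrix.one_mulVec]
  simp only [estErr, Pi.add_apply, Pi.sub_apply, e, h, lift]
  ring

end Step

end Errors

/-! ### Change of the four energies in one iteration -/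

section Decrease

variable {N : ℕ} {n : Fin N → ℕ}

/-- A weighted Cauchy-Schwarz inequality for the norm of a sum of three vectors. -/
lemma sq_norm_add_three_le {ι : Type*} [Fintype ι] {a b c : ι → ℝ} {p q r x y z : ℝ}
    (hp : 0 ≤ p) (hq : 0 ≤ q) (hr : 0 ≤ r) (hx : 0 ≤ x) (hy : 0 ≤ y) (hz : 0 ≤ z)
    (ha : a ⬝ᵥ a ≤ p * x) (hb : b ⬝ᵥ b ≤ q * y) (hc : c ⬝ᵥ c ≤ r * z) :
    (a + b + c) ⬝ᵥ (a + b + c) ≤ (p + q + r) * (x + y + z) := by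
  have cross : ∀ {d e : ι → ℝ} {s t : ℝ}, 0 ≤ s → 0 ≤ t → ∀ {u v : ℝ}, 0 ≤ u → 0 ≤ v →
      d ⬝ᵥ d ≤ s * u → e ⬝ᵥ e ≤ t * v → 2 * (d ⬝ᵥ e) ≤ s * v + t * u := by
    intro d e s t hs ht u v hu hv hd he
    refine abs_le_of_sq_le_sq' ?_ (by positivity) |>.2
    have h1 : (d ⬝ᵥ e) ^ 2 ≤ (s * u) * (t * v) := (dotProduct_sq_le d e).trans
      (mul_le_mul hd he (dotProduct_self_nonneg_real e) (by positivity))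
    nlinarith [sq_nonneg (s * v - t * u)]
  have h1 := cross hp hq hx hy ha hb
  have h2 := cross hp hr hx hz ha hc
  have h3 := cross hq hr hy hz hb hc
  simp only [add_dotProduct, dotProduct_add]
  rw [dotProduct_comm b a, dotProduct_comm c a, dotProduct_comm c b]
  linarith

variable {G : Digraph (Agent n)} {R C : ∀ i, Matrix (Fin (n i)) (Fin (n i)) ℝ}
  {f : Agent n → State n → ℝ} {lip : Agent n → ℝ} {l : ℝ} {S : Spectral n} {α : ℝ}

lemma lipSq_nonneg (lip : Agent n → ℝ) (i : Fin N) : 0 ≤ lipSq lip i :=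
  Finset.sum_nonneg fun _ _ => sq_nonneg _

lemma estErrSq_nonneg (S : Spectral n) (s : Vars n) (i : Fin N) : 0 ≤ estErrSq S s i :=
  Finset.sum_nonneg fun _ _ => Finset.sum_nonneg fun _ _ => sq_nonneg _

/-- Lipschitz bound for the total slope of a coalition whose agents use different arguments. -/
lemma sum_agentSlope_sub_sq_le
    (hlip : ∀ a x y, ‖gradient (f a) x - gradient (f a) y‖ ≤ lip a * ‖x - y‖) (i : Fin N)
    (z w : Fin (n i) → State n) :
    (∑ j, (agentSlope f ⟨i, j⟩ (z j) - agentSlope f ⟨i, j⟩ (w j))) ^ 2 ≤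
      n i * lipSq lip i * ∑ j, ‖z j - w j‖ ^ 2 := by
  rw [lipSq, Finset.mul_sum Finset.univ fun j : Fin (n i) => lip ⟨i, j⟩ ^ 2]
  refine Finset.sum_sq_le_sum_mul_sum_of_sq_le_mul _ (fun j _ => by positivity)
    (fun j _ => by positivity) fun j _ => ?_
  rw [mul_assoc]
  exact agentSlope_sub_sq_le hlip ⟨i, j⟩ _ _

lemma slope_gap_estimates_sq_le
    (hlip : ∀ a x y, ‖gradient (f a) x - gradient (f a) y‖ ≤ lip a * ‖x - y‖) (s : Vars n)
    (i : Fin N) :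
    (∑ j : Fin (n i), (agentSlope f ⟨i, j⟩ (s.ξ ⟨i, j⟩) -
      agentSlope f ⟨i, j⟩ (spread n (avgState S s.x)))) ^ 2 ≤
      n i * lipSq lip i * estErrSq S s i := by
  have h := sum_agentSlope_sub_sq_le hlip i (fun j => s.ξ ⟨i, j⟩)
    fun _ => spread n (avgState S s.x)
  simpa only [norm_sub_spread_avg_sq, estErrSq] using h

/-- The search directions vanish at the equilibrium when all errors vanish. The three terms of `b₀`
come from splitting them into the tracking error, the effect of the estimation errors and the effect
of the distance of the averages from the equilibrium. -/
lemma trackSum_sq_le (hn : ∀ i, 0 < n i)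
    (hlip : ∀ a x y, ‖gradient (f a) x - gradient (f a) y‖ ≤ lip a * ‖x - y‖)
    {s : Vars n} (hs : IsTracking f s) {y : EuclideanSpace ℝ (Fin N)}
    (hy : ∀ i, ∑ j : Fin (n i), agentSlope f ⟨i, j⟩ (spread n y) = 0) (i : Fin N) :
    trackSum s i ⬝ᵥ trackSum s i ≤ b₀ lip S i *
      ((1 / n i : ℝ) * (trackErr S s i ⬝ᵥ trackErr S s i) + estErrSq S s i +
        ‖avgState S s.x - y‖ ^ 2) := by
  have hn0 : (0 : ℝ) < n i := by exact_mod_cast hn i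
  set c₁ := ∑ j : Fin (n i), (agentSlope f ⟨i, j⟩ (s.ξ ⟨i, j⟩) -
      agentSlope f ⟨i, j⟩ (spread n (avgState S s.x))) with hc₁
  set c₂ := ∑ j : Fin (n i), (agentSlope f ⟨i, j⟩ (spread n (avgState S s.x)) -
      agentSlope f ⟨i, j⟩ (spread n y)) with hc₂
  have h1 : c₁ ^ 2 ≤ n i * lipSq lip i * estErrSq S s i := slope_gap_estimates_sq_le hlip s i
  have h2 : c₂ ^ 2 ≤ n i * lipSq lip i * (n i * ((⨆ p : Fin N, (n p : ℝ)) *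
      ‖avgState S s.x - y‖ ^ 2)) := by
    have h := sum_agentSlope_sub_sq_le hlip i (fun _ => spread n (avgState S s.x))
      fun _ => spread n y
    refine h.trans (mul_le_mul_of_nonneg_left ?_ (mul_nonneg hn0.le (lipSq_nonneg lip i)))
    rw [Finset.sum_const, Finset.card_univ, Fintype.card_fin, nsmul_eq_mul, ← spreadCLM_apply,
      ← spreadCLM_apply, ← map_sub, spreadCLM_apply]
    exact mul_le_mul_of_nonneg_left (norm_spread_sq_le _) hn0.le
  have hsum : ∑ j, trackSum s i j = c₁ + c₂ := by
    rw [hc₁, hc₂, ← Finset.sum_add_distrib]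
    simp only [sub_add_sub_cancel]
    rw [Finset.sum_sub_distrib, hy i, sub_zero, hs i]
  have hdec : trackSum s i = trackErr S s i + (c₁ / n i) • S.v i + (c₂ / n i) • S.v i := by
    conv_lhs => rw [trackSum_eq S s i, hsum, add_div, add_smul, ← add_assoc]
  have hsup : (0 : ℝ) ≤ ⨆ p : Fin N, (n p : ℝ) := Real.iSup_nonneg fun p => Nat.cast_nonneg _
  have hb : b₀ lip S i = n i + (1 / (n i : ℝ)) * vecNorm (S.v i) ^ 2 * lipSq lip i +
      (⨆ p : Fin N, (n p : ℝ)) * vecNorm (S.v i) ^ 2 * lipSq lip i := by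
    rw [b₀]; ring
  have hL := lipSq_nonneg lip i
  have hv : 0 ≤ vecNorm (S.v i) ^ 2 := sq_nonneg _
  rw [hdec, hb]
  refine sq_norm_add_three_le hn0.le (by positivity) (by positivity)
    (mul_nonneg (by positivity) (dotProduct_self_nonneg_real _)) (estErrSq_nonneg S s i) (sq_nonneg _)
    ?_ ?_ ?_
  · rw [← mul_assoc, mul_one_div_cancel hn0.ne', one_mul]
  · rw [smul_dotProduct, dotProduct_smul, ← vecNorm_sq, smul_eq_mul, smul_eq_mul]
    calc c₁ / n i * (c₁ / n i * vecNorm (S.v i) ^ 2)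
        = c₁ ^ 2 * (vecNorm (S.v i) ^ 2 / n i ^ 2) := by ring
      _ ≤ n i * lipSq lip i * estErrSq S s i * (vecNorm (S.v i) ^ 2 / n i ^ 2) :=
          mul_le_mul_of_nonneg_right h1 (by positivity)
      _ = _ := by field_simp
  · rw [smul_dotProduct, dotProduct_smul, ← vecNorm_sq, smul_eq_mul, smul_eq_mul]
    calc c₂ / n i * (c₂ / n i * vecNorm (S.v i) ^ 2)
        = c₂ ^ 2 * (vecNorm (S.v i) ^ 2 / n i ^ 2) := by ring
      _ ≤ n i * lipSq lip i * (n i * ((⨆ p : Fin N, (n p : ℝ)) * ‖avgState S s.x - y‖ ^ 2)) *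
            (vecNorm (S.v i) ^ 2 / n i ^ 2) :=
          mul_le_mul_of_nonneg_right h2 (by positivity)
      _ = _ := by field_simp

/-- The squared distance of the averages from the equilibrium, with the weights for which the
contributions of the search directions combine to the pseudo-gradient. -/
noncomputable def avgEnergy (S : Spectral n) (α : ℝ) (y : EuclideanSpace ℝ (Fin N)) (s : Vars n) :
    ℝ :=
  ∑ i, (n i : ℝ) ^ 3 / (α * (S.u i ⬝ᵥ S.v i)) * (avgState S s.x i - y i) ^ 2

/-- The energy of the tracking errors. The factor `1 / n i` makes up for the Cauchy-Schwarz bound of a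
search direction, which is a sum of `n i` trackers. -/
noncomputable def trackEnergy (S : Spectral n) (s : Vars n) : ℝ :=
  ∑ i, (1 / n i : ℝ) * (trackErr S s i ⬝ᵥ S.Wc i *ᵥ trackErr S s i)

/-- The energy of the estimation errors. -/
noncomputable def estEnergy (S : Spectral n) (s : Vars n) : ℝ :=
  estErr S s ⬝ᵥ S.WM *ᵥ estErr S s

/-- The energy of the disagreements. -/
noncomputable def disagreementEnergy (S : Spectral n) (s : Vars n) : ℝ :=
  ∑ i, disagreement S s.x i ⬝ᵥ S.WR i *ᵥ disagreement S s.x i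

/-- The squared norm of the tracking errors, scaled as in `trackEnergy`. -/
noncomputable def trackErrSq (S : Spectral n) (s : Vars n) : ℝ :=
  ∑ i, (1 / n i : ℝ) * (trackErr S s i ⬝ᵥ trackErr S s i)

/-- The squared norm of the disagreements. -/
noncomputable def disagreementSq (S : Spectral n) (s : Vars n) : ℝ :=
  ∑ i, disagreement S s.x i ⬝ᵥ disagreement S s.x i

/-- The weights `nᵢ³ / (α uᵢᵀvᵢ)` turn the part of the search directions along `vᵢ` into the
pseudo-gradient at the averages, up to the effect of the estimation errors. -/
lemma avgEnergy_nextVars_le (hn : ∀ i, 0 < n i) (hC2 : ∀ a, ContDiff ℝ 2 (f a))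
    (hlip : ∀ a x y, ‖gradient (f a) x - gradient (f a) y‖ ≤ lip a * ‖x - y‖) (hl : 0 < l)
    (hmono : ∀ a b : EuclideanSpace ℝ (Fin N),
      l * ‖a - b‖ ^ 2 ≤ inner ℝ (a - b) (pseudoGradient f a - pseudoGradient f b))
    (hS : S.IsFor G R C) (huv : ∀ i, 0 < S.u i ⬝ᵥ S.v i) (hα : 0 < α)
    {s : Vars n} (hs : IsTracking f s) {y : EuclideanSpace ℝ (Fin N)}
    (hy : pseudoGradient f y = 0) :
    avgEnergy S α y (nextVars G R C f α s) ≤ avgEnergy S α y s - l * ‖avgState S s.x - y‖ ^ 2 +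
      βxψ l S * trackErrSq S s + βxξ (n := n) lip l * (estErr S s ⬝ᵥ estErr S s) +
      α * ∑ i, vecNorm (S.u i) ^ 2 / ((n i : ℝ) * (S.u i ⬝ᵥ S.v i)) *
        (trackSum s i ⬝ᵥ trackSum s i) := by
  set x := avgState S s.x with hx
  have hm := hmono x y
  rw [hy, sub_zero, PiLp.inner_apply] at hm
  simp only [PiLp.sub_apply, RCLike.inner_apply, conj_trivial] at hm
  have key : ∀ i, (n i : ℝ) ^ 3 / (α * (S.u i ⬝ᵥ S.v i)) *
      (avgState S (nextVars G R C f α s).x i - y i) ^ 2 ≤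
      (n i : ℝ) ^ 3 / (α * (S.u i ⬝ᵥ S.v i)) * (x i - y i) ^ 2 + l * (x i - y i) ^ 2 -
        2 * (pseudoGradient f x i * (x i - y i)) +
        βxψ l S * ((1 / n i : ℝ) * (trackErr S s i ⬝ᵥ trackErr S s i)) +
        βxξ (n := n) lip l * estErrSq S s i +
        α * (vecNorm (S.u i) ^ 2 / ((n i : ℝ) * (S.u i ⬝ᵥ S.v i)) *
        (trackSum s i ⬝ᵥ trackSum s i)) := by
    intro i
    have hn0 : (0 : ℝ) < n i := by exact_mod_cast hn i
    have huvi := huv i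
    set ω := S.u i ⬝ᵥ S.v i with hω
    set e := x i - y i with he
    set g := pseudoGradient f x i with hg
    set D := ∑ j : Fin (n i), (agentSlope f ⟨i, j⟩ (s.ξ ⟨i, j⟩) -
      agentSlope f ⟨i, j⟩ (spread n x)) with hD
    set τ := S.u i ⬝ᵥ trackErr S s i with hτ
    have hsum : ∑ j, trackSum s i j = D + g := by
      rw [hs i, hg, pseudoGradient_apply hC2, hD, Finset.sum_sub_distrib, sub_add_cancel]
    have huφ : S.u i ⬝ᵥ trackSum s i = τ + (D + g) / n i * ω := by
      rw [trackSum_eq S s i, dotProduct_add, dotProduct_smul, smul_eq_mul, hsum]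
    have hDsq : D ^ 2 ≤ n i * lipSq lip i * estErrSq S s i := slope_gap_estimates_sq_le hlip s i
    have hτsq : τ ^ 2 ≤ vecNorm (S.u i) ^ 2 * (trackErr S s i ⬝ᵥ trackErr S s i) := by
      rw [vecNorm_sq]; exact dotProduct_sq_le _ _
    have hφsq : (S.u i ⬝ᵥ trackSum s i) ^ 2 ≤
        vecNorm (S.u i) ^ 2 * (trackSum s i ⬝ᵥ trackSum s i) := by
      rw [vecNorm_sq]; exact dotProduct_sq_le _ _
    have h1 : 2 / l * D ^ 2 ≤ βxξ (n := n) lip l * estErrSq S s i := by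
      have hsup := le_ciSup (f := fun i : Fin N => (n i : ℝ) * lipSq lip i)
        (Set.finite_range _).bddAbove i
      calc 2 / l * D ^ 2 ≤ 2 / l * (n i * lipSq lip i * estErrSq S s i) :=
            mul_le_mul_of_nonneg_left hDsq (by positivity)
        _ ≤ 2 / l * ((⨆ i : Fin N, (n i : ℝ) * lipSq lip i) * estErrSq S s i) :=
            mul_le_mul_of_nonneg_left
              (mul_le_mul_of_nonneg_right hsup (estErrSq_nonneg S s i)) (by positivity)
        _ = _ := by rw [βxξ]; ring
    have h2 : 2 / l * (n i / ω * τ) ^ 2 ≤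
        βxψ l S * ((1 / n i : ℝ) * (trackErr S s i ⬝ᵥ trackErr S s i)) := by
      have hsup := le_ciSup (f := fun i : Fin N =>
        (n i : ℝ) ^ 3 * vecNorm (S.u i) ^ 2 / (S.u i ⬝ᵥ S.v i) ^ 2)
        (Set.finite_range _).bddAbove i
      have hT := dotProduct_self_nonneg_real (trackErr S s i)
      calc 2 / l * (n i / ω * τ) ^ 2 = 2 / l * ((n i / ω) ^ 2 * τ ^ 2) := by ring
        _ ≤ 2 / l * ((n i / ω) ^ 2 *
              (vecNorm (S.u i) ^ 2 * (trackErr S s i ⬝ᵥ trackErr S s i))) :=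
            mul_le_mul_of_nonneg_left (mul_le_mul_of_nonneg_left hτsq (sq_nonneg _))
              (by positivity)
        _ = 2 / l * ((n i : ℝ) ^ 3 * vecNorm (S.u i) ^ 2 / ω ^ 2) *
              ((1 / n i : ℝ) * (trackErr S s i ⬝ᵥ trackErr S s i)) := by field_simp
        _ ≤ _ := by
            rw [βxψ]
            exact mul_le_mul_of_nonneg_right
              (mul_le_mul_of_nonneg_left hsup (by positivity)) (by positivity)
    have h3 : α / (n i * ω) * (S.u i ⬝ᵥ trackSum s i) ^ 2 ≤
        α * (vecNorm (S.u i) ^ 2 / ((n i : ℝ) * ω) * (trackSum s i ⬝ᵥ trackSum s i)) := by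
      refine (mul_le_mul_of_nonneg_left hφsq (by positivity)).trans (le_of_eq ?_)
      ring
    -- Young, for the terms in which the distance to the equilibrium meets an error.
    have young : ∀ d : ℝ, -(2 * e * d) ≤ l / 2 * e ^ 2 + 2 / l * d ^ 2 := by
      intro d
      have h : l / 2 * e ^ 2 + 2 / l * d ^ 2 + 2 * e * d = (l * e + 2 * d) ^ 2 / (2 * l) := by
        field_simp; ring
      have : 0 ≤ (l * e + 2 * d) ^ 2 / (2 * l) := by positivity
      linarith
    have y1 := young D
    have y2 := young (n i / ω * τ)
    have hexp : (n i : ℝ) ^ 3 / (α * ω) * (avgState S (nextVars G R C f α s).x i - y i) ^ 2 =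
        (n i : ℝ) ^ 3 / (α * ω) * e ^ 2 - 2 * e * (n i / ω * τ) - 2 * e * D - 2 * (g * e) +
          α / (n i * ω) * (S.u i ⬝ᵥ trackSum s i) ^ 2 := by
      rw [avgState_nextVars hS, huφ]
      have : avgState S s.x i - α / (n i : ℝ) ^ 2 * (τ + (D + g) / n i * ω) - y i =
          e - α / (n i : ℝ) ^ 2 * (τ + (D + g) / n i * ω) := by rw [he, hx]; ring
      rw [this]
      field_simp
      ring
    rw [hexp]
    linarith
  have hsum := Finset.sum_le_sum fun i (_ : i ∈ Finset.univ) => key i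
  simp only [Finset.sum_add_distrib, Finset.sum_sub_distrib, ← Finset.mul_sum] at hsum
  have hE : ‖x - y‖ ^ 2 = ∑ i, (x i - y i) ^ 2 := by
    rw [EuclideanSpace.real_norm_sq_eq]; rfl
  rw [estErr_dotProduct_self]
  simp only [avgEnergy, trackErrSq]
  rw [hE] at hm ⊢
  linarith

lemma disagreement_lift_sq (s : Vars n) :
    lift (fun a => disagreement S s.x a.1 a.2) ⬝ᵥ lift (fun a => disagreement S s.x a.1 a.2) =
      nSum n * disagreementSq S s := by
  rw [lift_dotProduct_self, disagreementSq]
  simp only [dotProduct, sq]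

lemma sum_norm_nextξ_sub_sq_le (s : Vars n) :
    ∑ a, ‖(nextVars G R C f α s).ξ a - s.ξ a‖ ^ 2 ≤
      specNorm (estMat G) ^ 2 *
        (2 * (estErr S s ⬝ᵥ estErr S s) + 2 * (nSum n * disagreementSq S s)) := by
  set z : Agent n × Agent n → ℝ := fun q => s.ξ q.1 q.2 - s.x q.2 with hz
  have e : ∑ a, ‖(nextVars G R C f α s).ξ a - s.ξ a‖ ^ 2 =
      (estMat G *ᵥ z) ⬝ᵥ (estMat G *ᵥ z) := by
    simp only [dotProduct, Fintype.sum_prod_type]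
    refine Finset.sum_congr rfl fun a _ => ?_
    rw [EuclideanSpace.real_norm_sq_eq]
    refine Finset.sum_congr rfl fun p _ => ?_
    have h : (nextVars G R C f α s).ξ a p = _ := nextξ_apply G s a p
    rw [PiLp.sub_apply, h]
    ring
  rw [e]
  refine (mulVec_dotProduct_self_le _ _).trans (mul_le_mul_of_nonneg_left ?_ (sq_nonneg _))
  rw [hz, sub_eq_estErr_sub_lift (S := S), sub_eq_add_neg, ← disagreement_lift_sq]
  refine (dotProduct_add_self_le _ _).trans (le_of_eq ?_)
  rw [neg_dotProduct_neg]

lemma trackEnergy_nextVars_le (hn : ∀ i, 0 < n i)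
    (hlip : ∀ a x y, ‖gradient (f a) x - gradient (f a) y‖ ≤ lip a * ‖x - y‖)
    (hS : S.IsFor G R C) (hC : IsColWeights G C) (s : Vars n) :
    trackEnergy S (nextVars G R C f α s) ≤ trackEnergy S s - 1 / 2 * trackErrSq S s +
      βψξ G C lip S * (estErr S s ⬝ᵥ estErr S s) + βψx G C lip S * disagreementSq S s := by
  set c : ∀ i, ℝ := fun i =>
    2 * specNorm ((C i - rightProj (S.v i))ᵀ * S.Wc i * (1 - rightProj (S.v i))) ^ 2
      + specNorm ((1 - rightProj (S.v i))ᵀ * S.Wc i * (1 - rightProj (S.v i))) with hc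
  have hc0 : ∀ i, 0 ≤ c i := fun i =>
    add_nonneg (mul_nonneg two_pos.le (sq_nonneg _)) (specNorm_nonneg _)
  set B := ⨆ a : Agent n, c a.1 * lip a ^ 2 with hB
  have hBle : ∀ a : Agent n, c a.1 * lip a ^ 2 ≤ B := fun a =>
    le_ciSup (f := fun a : Agent n => c a.1 * lip a ^ 2) (Set.finite_range _).bddAbove a
  have hB0 : 0 ≤ B := Real.iSup_nonneg fun a => mul_nonneg (hc0 _) (sq_nonneg _)
  have key : ∀ i, (1 / n i : ℝ) * (trackErr S (nextVars G R C f α s) i ⬝ᵥ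
      S.Wc i *ᵥ trackErr S (nextVars G R C f α s) i) ≤
      (1 / n i : ℝ) * (trackErr S s i ⬝ᵥ S.Wc i *ᵥ trackErr S s i) -
        1 / 2 * ((1 / n i : ℝ) * (trackErr S s i ⬝ᵥ trackErr S s i)) +
        B * ∑ j : Fin (n i), ‖(nextVars G R C f α s).ξ ⟨i, j⟩ - s.ξ ⟨i, j⟩‖ ^ 2 := by
    intro i
    have hn0 : (0 : ℝ) < n i := by exact_mod_cast hn i
    rw [trackErr_nextVars hn hS hC]
    set δ : Fin (n i) → ℝ := fun j => agentSlope f ⟨i, j⟩ ((nextVars G R C f α s).ξ ⟨i, j⟩) -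
            agentSlope f ⟨i, j⟩ (s.ξ ⟨i, j⟩) with hδ
    have h := (hS.Wc_lyap i).perturbed_step (1 - rightProj (S.v i)) (trackErr S s i) δ
    have h2 : (1 / n i : ℝ) * (c i * (δ ⬝ᵥ δ)) ≤
        B * ∑ j : Fin (n i), ‖(nextVars G R C f α s).ξ ⟨i, j⟩ - s.ξ ⟨i, j⟩‖ ^ 2 := by
      simp only [dotProduct, Finset.mul_sum]
      refine Finset.sum_le_sum fun j _ => ?_
      have h3 := agentSlope_sub_sq_le hlip ⟨i, j⟩ ((nextVars G R C f α s).ξ ⟨i, j⟩) (s.ξ ⟨i, j⟩)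
      calc (1 / n i : ℝ) * (c i * (δ j * δ j)) = (1 / n i : ℝ) * c i * δ j ^ 2 := by ring
        _ ≤ (1 / n i : ℝ) * c i * (n i * (lip ⟨i, j⟩ ^ 2 *
              ‖(nextVars G R C f α s).ξ ⟨i, j⟩ - s.ξ ⟨i, j⟩‖ ^ 2)) :=
            mul_le_mul_of_nonneg_left h3 (mul_nonneg (by positivity) (hc0 i))
        _ = c i * lip ⟨i, j⟩ ^ 2 *
              ‖(nextVars G R C f α s).ξ ⟨i, j⟩ - s.ξ ⟨i, j⟩‖ ^ 2 := by field_simp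
        _ ≤ _ := mul_le_mul_of_nonneg_right (hBle ⟨i, j⟩) (sq_nonneg _)
    have h4 := mul_le_mul_of_nonneg_left h (by positivity : (0 : ℝ) ≤ 1 / n i)
    refine h4.trans ?_
    rw [mul_add, mul_sub]
    linarith
  have hsum := Finset.sum_le_sum fun i (_ : i ∈ Finset.univ) => key i
  simp only [Finset.sum_add_distrib, Finset.sum_sub_distrib, ← Finset.mul_sum] at hsum
  have hξ := mul_le_mul_of_nonneg_left
    (sum_norm_nextξ_sub_sq_le (G := G) (R := R) (C := C) (f := f) (S := S) (α := α) s) hB0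
  rw [Fintype.sum_sigma] at hξ
  have hβ : βψξ G C lip S = 2 * B * specNorm (estMat G) ^ 2 := rfl
  rw [βψx, hβ]
  simp only [trackEnergy, trackErrSq]
  linarith

lemma estEnergy_nextVars_le (hS : S.IsFor G R C) (hα : 0 < α) (hα1 : α ≤ 1) (s : Vars n) :
    estEnergy S (nextVars G R C f α s) ≤ estEnergy S s - 1 / 2 * (estErr S s ⬝ᵥ estErr S s) +
      βξx G S * disagreementSq S s +
      α * ∑ i, nSum n * κM G S * specNorm ((1 / (n i : ℝ)) • leftProj (S.u i)) ^ 2 *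
        (trackSum s i ⬝ᵥ trackSum s i) := by
  set Δ : Agent n → ℝ := fun a =>
    avgState S (nextVars G R C f α s).x a.1 - avgState S s.x a.1 with hΔ
  set X := lift fun a => disagreement S s.x a.1 a.2 with hX
  have hκ : 0 ≤ κM G S :=
    add_nonneg (mul_nonneg (by norm_num) (sq_nonneg _))
      (mul_nonneg two_pos.le (specNorm_nonneg _))
  have h := hS.WM_lyap.perturbed_step 1 (estErr S s) (estMat G *ᵥ X - lift Δ)
  rw [← estErr_nextVars, Matrix.transpose_one, one_mul, mul_one, mul_one] at h
  have hw : (estMat G *ᵥ X - lift Δ) ⬝ᵥ (estMat G *ᵥ X - lift Δ) ≤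
      2 * (specNorm (estMat G) ^ 2 * (nSum n * disagreementSq S s)) +
        2 * (nSum n * ∑ i, ∑ j : Fin (n i), Δ ⟨i, j⟩ ^ 2) := by
    have h1 := dotProduct_add_self_le (estMat G *ᵥ X) (-lift Δ)
    rw [neg_dotProduct_neg, lift_dotProduct_self, ← sub_eq_add_neg] at h1
    have h2 := mulVec_dotProduct_self_le (estMat G) X
    rw [hX, disagreement_lift_sq, ← hX] at h2
    linarith
  have hΔsq : ∀ i, ∑ j : Fin (n i), Δ ⟨i, j⟩ ^ 2 ≤
      α * (specNorm ((1 / (n i : ℝ)) • leftProj (S.u i)) ^ 2 *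
        (trackSum s i ⬝ᵥ trackSum s i)) := by
    intro i
    have e : ∑ j : Fin (n i), Δ ⟨i, j⟩ ^ 2 =
        α ^ 2 * (((1 / (n i : ℝ)) • leftProj (S.u i)) *ᵥ trackSum s i ⬝ᵥ
          ((1 / (n i : ℝ)) • leftProj (S.u i)) *ᵥ trackSum s i) := by
      simp only [dotProduct, Finset.mul_sum]
      refine Finset.sum_congr rfl fun j _ => ?_
      simp only [hΔ, avgState_nextVars hS, Matrix.smul_mulVec, leftProj_mulVec, Pi.smul_apply,
        smul_eq_mul, dotProduct]
      ring
    rw [e]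
    have h0 : 0 ≤ specNorm ((1 / (n i : ℝ)) • leftProj (S.u i)) ^ 2 *
        (trackSum s i ⬝ᵥ trackSum s i) := mul_nonneg (sq_nonneg _) (dotProduct_self_nonneg_real _)
    refine (mul_le_mul_of_nonneg_left (mulVec_dotProduct_self_le _ _) (sq_nonneg α)).trans
      (mul_le_mul_of_nonneg_right ?_ h0)
    nlinarith
  have hΔsum := Finset.sum_le_sum fun i (_ : i ∈ Finset.univ) => hΔsq i
  rw [← Finset.mul_sum] at hΔsum
  have e1 : α * ∑ i, nSum n * κM G S * specNorm ((1 / (n i : ℝ)) • leftProj (S.u i)) ^ 2 *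
      (trackSum s i ⬝ᵥ trackSum s i) = nSum n * κM G S * (α *
        ∑ i, specNorm ((1 / (n i : ℝ)) • leftProj (S.u i)) ^ 2 *
          (trackSum s i ⬝ᵥ trackSum s i)) := by
    simp only [mul_assoc, Finset.mul_sum]
    refine Finset.sum_congr rfl fun i _ => ?_
    ring
  -- Splitting the perturbation into its two parts doubles this constant.
  have hκ2 : 2 * specNorm ((errMat G)ᵀ * S.WM) ^ 2 + specNorm S.WM = κM G S / 2 := by
    rw [κM]; ring
  rw [hκ2] at h
  have h5 := mul_le_mul_of_nonneg_left hw (div_nonneg hκ two_pos.le)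
  have h6 := mul_le_mul_of_nonneg_left hΔsum (mul_nonneg (Nat.cast_nonneg (nSum n)) hκ)
  rw [e1, βξx, estEnergy, estEnergy]
  linarith

lemma disagreementEnergy_nextVars_le (hn : ∀ i, 0 < n i) (hS : S.IsFor G R C)
    (hR : IsRowWeights G R) (hα : 0 < α) (hα1 : α ≤ 1) (s : Vars n) :
    disagreementEnergy S (nextVars G R C f α s) ≤
      disagreementEnergy S s - 1 / 2 * disagreementSq S s +
      α * ∑ i, 1 / (n i : ℝ) ^ 2 *
        (2 * specNorm ((R i - leftProj (S.u i))ᵀ * S.WR i * (1 - leftProj (S.u i))) ^ 2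
          + specNorm ((1 - leftProj (S.u i))ᵀ * S.WR i * (1 - leftProj (S.u i)))) *
        (trackSum s i ⬝ᵥ trackSum s i) := by
  simp only [disagreementEnergy, disagreementSq, Finset.mul_sum]
  rw [← Finset.sum_sub_distrib, ← Finset.sum_add_distrib]
  refine Finset.sum_le_sum fun i _ => ?_
  rw [disagreement_nextVars hn hS hR]
  refine ((hS.WR_lyap i).perturbed_step (1 - leftProj (S.u i)) _ _).trans ?_
  set c := 2 * specNorm ((R i - leftProj (S.u i))ᵀ * S.WR i * (1 - leftProj (S.u i))) ^ 2
          + specNorm ((1 - leftProj (S.u i))ᵀ * S.WR i * (1 - leftProj (S.u i))) with hc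
  have hc0 : 0 ≤ c := add_nonneg (mul_nonneg two_pos.le (sq_nonneg _)) (specNorm_nonneg _)
  refine add_le_add_right ?_ _
  rw [smul_dotProduct, dotProduct_smul, smul_eq_mul, smul_eq_mul]
  have h0 : 0 ≤ 1 / (n i : ℝ) ^ 2 * c * (trackSum s i ⬝ᵥ trackSum s i) :=
    mul_nonneg (mul_nonneg (by positivity) hc0) (dotProduct_self_nonneg_real _)
  calc c * (-(α / n i) * (-(α / n i) * (trackSum s i ⬝ᵥ trackSum s i)))
      = α ^ 2 * (1 / (n i : ℝ) ^ 2 * c * (trackSum s i ⬝ᵥ trackSum s i)) := by ring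
    _ ≤ _ := mul_le_mul_of_nonneg_right (by nlinarith) h0

end Decrease

/-! ### Positivity of the constants and decay of the energy -/

section Constants

variable {N : ℕ} {n : Fin N → ℕ} {G : Digraph (Agent n)}
  {R C : ∀ i, Matrix (Fin (n i)) (Fin (n i)) ℝ}
  {f : Agent n → State n → ℝ} {lip : Agent n → ℝ} {l : ℝ} {S : Spectral n} {α : ℝ}

lemma iSup_pos_of_pos {ι : Type*} [Finite ι] {g : ι → ℝ} {i : ι} (h : 0 < g i) : 0 < ⨆ i, g i :=
  h.trans_le (le_ciSup (Set.finite_range g).bddAbove i)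

lemma le_iSup_of_finite {ι : Type*} [Finite ι] (g : ι → ℝ) (i : ι) : g i ≤ ⨆ i, g i :=
  le_ciSup (Set.finite_range g).bddAbove i

lemma nonempty_fin_of_nSum (hcard : 2 ≤ nSum n) : Nonempty (Fin N) := by
  by_contra h
  rw [not_nonempty_iff] at h
  simp [nSum] at hcard

lemma specNorm_pos {ι : Type*} [Fintype ι] [DecidableEq ι] {A : Matrix ι ι ℝ} (hA : A ≠ 0) :
    0 < specNorm A := by
  refine norm_pos_iff.2 fun h => hA ?_
  exact (map_eq_zero_iff _ (Matrix.toEuclideanCLM (n := ι) (𝕜 := ℝ)).injective).1 h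

lemma vecNorm_sq_pos {m : ℕ} (hm : 0 < m) {u : Fin m → ℝ} (hu : ∀ j, 0 < u j) :
    0 < vecNorm u ^ 2 := by
  rw [vecNorm_sq]
  exact Finset.sum_pos (fun j _ => mul_pos (hu j) (hu j)) ⟨⟨0, hm⟩, Finset.mem_univ _⟩

/-- Otherwise `errMat G = 1`, which has no Lyapunov matrix. -/
lemma estMat_ne_zero [Nonempty (Agent n)] (hS : S.IsFor G R C) : estMat G ≠ 0 := by
  intro h
  have h1 := hS.WM_lyap.2
  rw [errMat, h, sub_zero, Matrix.transpose_one, one_mul, mul_one, sub_self] at h1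
  exact one_ne_zero (neg_eq_zero.1 h1.symm)

lemma κM_pos [Nonempty (Agent n)] (hS : S.IsFor G R C) : 0 < κM G S :=
  add_pos_of_nonneg_of_pos (mul_nonneg (by norm_num) (sq_nonneg _))
    (mul_pos two_pos (one_pos.trans_le hS.WM_lyap.one_le_specNorm))

lemma βψξ_nonneg : 0 ≤ βψξ G C lip S :=
  mul_nonneg (mul_nonneg two_pos.le (Real.iSup_nonneg fun _ =>
    mul_nonneg (add_nonneg (mul_nonneg two_pos.le (sq_nonneg _)) (specNorm_nonneg _))
      (sq_nonneg _))) (sq_nonneg _)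

lemma βxψ_pos [Nonempty (Fin N)] (hn : ∀ i, 0 < n i) (hl : 0 < l) (hu : ∀ i j, 0 < S.u i j)
    (huv : ∀ i, 0 < S.u i ⬝ᵥ S.v i) : 0 < βxψ l S := by
  obtain ⟨i⟩ := ‹Nonempty (Fin N)›
  have hn0 : (0 : ℝ) < n i := by exact_mod_cast hn i
  have h1 := vecNorm_sq_pos (hn i) (hu i)
  have h2 := huv i
  exact mul_pos (by positivity) (iSup_pos_of_pos (i := i) (by positivity))

/-- The gradients cannot all be constant, because the pseudo-gradient is strongly monotone. -/
lemma βxξ_pos [Nonempty (Fin N)] (hC2 : ∀ a, ContDiff ℝ 2 (f a))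
    (hlip : ∀ a x y, ‖gradient (f a) x - gradient (f a) y‖ ≤ lip a * ‖x - y‖) (hl : 0 < l)
    (hmono : ∀ a b : EuclideanSpace ℝ (Fin N),
      l * ‖a - b‖ ^ 2 ≤ inner ℝ (a - b) (pseudoGradient f a - pseudoGradient f b))
    (hn : ∀ i, 0 < n i) : 0 < βxξ (n := n) lip l := by
  obtain ⟨i, hi⟩ : ∃ i, 0 < lipSq lip i := by
    by_contra! h
    have h0 : ∀ i, lipSq lip i = 0 := fun i => le_antisymm (h i) (lipSq_nonneg lip i)
    obtain ⟨i₀⟩ := ‹Nonempty (Fin N)›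
    have hpg : pseudoGradient f (EuclideanSpace.single i₀ 1) = pseudoGradient f 0 := by
      ext i
      have h1 := sum_agentSlope_sub_sq_le hlip i
        (fun _ => spread n (EuclideanSpace.single i₀ 1)) fun _ => spread n 0
      rw [h0 i, mul_zero, zero_mul, Finset.sum_sub_distrib] at h1
      have h2 := pow_eq_zero_iff two_ne_zero |>.1 (le_antisymm h1 (sq_nonneg _))
      rw [pseudoGradient_apply hC2, pseudoGradient_apply hC2]
      exact sub_eq_zero.1 h2
    have h3 := hmono (EuclideanSpace.single i₀ 1) 0
    rw [hpg, sub_self, inner_zero_right, sub_zero] at h3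
    simp at h3
    linarith
  have hn0 : (0 : ℝ) < n i := by exact_mod_cast hn i
  exact div_pos (mul_pos two_pos (iSup_pos_of_pos (i := i) (mul_pos hn0 hi))) hl

lemma b₀_pos (hn : ∀ i, 0 < n i) (i : Fin N) : 0 < b₀ lip S i := by
  have hn0 : (0 : ℝ) < n i := by exact_mod_cast hn i
  have hsup : (0 : ℝ) ≤ ⨆ p : Fin N, (n p : ℝ) := Real.iSup_nonneg fun p => Nat.cast_nonneg _
  have hL := lipSq_nonneg lip i
  rw [b₀]
  positivity

lemma b₁_pos (hn : ∀ i, 0 < n i) (hu : ∀ i j, 0 < S.u i j)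
    (huv : ∀ i, 0 < S.u i ⬝ᵥ S.v i) (i : Fin N) : 0 < b₁ lip S i := by
  have hn0 : (0 : ℝ) < n i := by exact_mod_cast hn i
  exact mul_pos (div_pos (vecNorm_sq_pos (hn i) (hu i)) (mul_pos hn0 (huv i))) (b₀_pos hn i)

lemma b₂_nonneg [Nonempty (Agent n)] (hn : ∀ i, 0 < n i) (hS : S.IsFor G R C) (i : Fin N) :
    0 ≤ b₂ G lip S i :=
  mul_nonneg (mul_nonneg (mul_nonneg (Nat.cast_nonneg _) (κM_pos hS).le) (sq_nonneg _))
    (b₀_pos hn i).le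

lemma b₃_nonneg (hn : ∀ i, 0 < n i) (i : Fin N) : 0 ≤ b₃ R lip S i :=
  mul_nonneg (mul_nonneg (by positivity)
    (add_nonneg (mul_nonneg two_pos.le (sq_nonneg _)) (specNorm_nonneg _))) (b₀_pos hn i).le

lemma γ₁_pos (h : 0 < βxψ l S) : 0 < γ₁ l S := mul_pos four_pos h

lemma γ₂_pos (h1 : 0 < βxψ l S) (h2 : 0 < βxξ (n := n) lip l) : 0 < γ₂ G C lip l S :=
  mul_pos four_pos (add_pos_of_pos_of_nonneg h2 (mul_nonneg βψξ_nonneg (γ₁_pos h1).le))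

lemma γ₃_pos (hcard : 2 ≤ nSum n) [Nonempty (Agent n)] (hS : S.IsFor G R C) (h1 : 0 < βxψ l S)
    (h2 : 0 < βxξ (n := n) lip l) : 0 < γ₃ G C lip l S := by
  have hn0 : (0 : ℝ) < nSum n := by exact_mod_cast (by omega : 0 < nSum n)
  refine mul_pos four_pos (add_pos_of_nonneg_of_pos ?_ ?_)
  · exact mul_nonneg (mul_nonneg hn0.le βψξ_nonneg) (γ₁_pos h1).le
  · exact mul_pos (mul_pos (mul_pos hn0 (κM_pos hS)) (pow_pos (specNorm_pos (estMat_ne_zero hS)) 2))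
      (γ₂_pos h1 h2)

lemma sigma_pos [Nonempty (Fin N)] [Nonempty (Agent n)] (hn : ∀ i, 0 < n i) (hS : S.IsFor G R C)
    (hu : ∀ i j, 0 < S.u i j) (huv : ∀ i, 0 < S.u i ⬝ᵥ S.v i)
    (h2 : 0 < γ₂ G C lip l S) (h3 : 0 < γ₃ G C lip l S) : 0 < sigma G R C lip l S := by
  obtain ⟨i⟩ := ‹Nonempty (Fin N)›
  refine add_pos_of_pos_of_nonneg (add_pos_of_pos_of_nonneg
    (iSup_pos_of_pos (b₁_pos hn hu huv i)) ?_) ?_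
  · exact mul_nonneg h2.le (Real.iSup_nonneg fun i => b₂_nonneg hn hS i)
  · exact mul_nonneg h3.le (Real.iSup_nonneg fun i => b₃_nonneg hn i)

lemma stepBound_pos [Nonempty (Fin N)] (hl : 0 < l) (h1 : 0 < γ₁ l S) (h2 : 0 < γ₂ G C lip l S)
    (hσ : 0 < sigma G R C lip l S) : 0 < stepBound G R C lip l S := by
  have hN : (0 : ℝ) < N := by
    obtain ⟨i⟩ := ‹Nonempty (Fin N)›
    exact_mod_cast i.pos
  rw [stepBound]
  exact lt_min (lt_min (by positivity) (by positivity)) (lt_min (by positivity) one_pos)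

lemma decay_pos [Nonempty (Fin N)] [Nonempty (Agent n)] (hn : ∀ i, 0 < n i) (hl : 0 < l)
    (hS : S.IsFor G R C) (huv : ∀ i, 0 < S.u i ⬝ᵥ S.v i) (hα : 0 < α) : 0 < decay l S α := by
  obtain ⟨i⟩ := ‹Nonempty (Fin N)›
  have hn0 : (0 : ℝ) < n i := by exact_mod_cast hn i
  have hne : Nonempty (Fin (n i)) := ⟨⟨0, hn i⟩⟩
  have huvi := huv i
  have h1 : 0 < ⨆ i : Fin N, (n i : ℝ) ^ 3 / (α * (S.u i ⬝ᵥ S.v i)) :=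
    iSup_pos_of_pos (i := i) (by positivity)
  have h2 : 0 < ⨆ i, specNorm (S.Wc i) :=
    iSup_pos_of_pos (i := i) (one_pos.trans_le (hS.Wc_lyap i).one_le_specNorm)
  have h3 : 0 < ⨆ i, specNorm (S.WR i) :=
    iSup_pos_of_pos (i := i) (one_pos.trans_le (hS.WR_lyap i).one_le_specNorm)
  have h4 : 0 < specNorm S.WM := one_pos.trans_le hS.WM_lyap.one_le_specNorm
  rw [decay]
  exact lt_min (lt_min (by positivity) (by positivity)) (lt_min (by positivity) (by positivity))

lemma decay_lt_one [Nonempty (Agent n)] (hS : S.IsFor G R C) : decay l S α < 1 := by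
  refine ((min_le_right _ _).trans (min_le_left _ _)).trans_lt ?_
  have h := hS.WM_lyap.one_le_specNorm
  rw [div_lt_one (by linarith)]
  linarith

end Constants

section Convergence

variable {N : ℕ} {n : Fin N → ℕ} {G : Digraph (Agent n)}
  {R C : ∀ i, Matrix (Fin (n i)) (Fin (n i)) ℝ}
  {f : Agent n → State n → ℝ} {lip : Agent n → ℝ} {l : ℝ} {S : Spectral n} {α : ℝ}

/-- The Lyapunov function of the algorithm for the equilibrium `spread n y`. -/
noncomputable def energy (G : Digraph (Agent n)) (C : ∀ i, Matrix (Fin (n i)) (Fin (n i)) ℝ)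
    (lip : Agent n → ℝ) (l : ℝ) (S : Spectral n) (α : ℝ) (y : EuclideanSpace ℝ (Fin N))
    (s : Vars n) : ℝ :=
  avgEnergy S α y s + γ₁ l S * trackEnergy S s + γ₂ G C lip l S * estEnergy S s +
    γ₃ G C lip l S * disagreementEnergy S s

lemma trackErrSq_nonneg (S : Spectral n) (s : Vars n) : 0 ≤ trackErrSq S s :=
  Finset.sum_nonneg fun _ _ => mul_nonneg (by positivity) (dotProduct_self_nonneg_real _)

lemma disagreementSq_nonneg (S : Spectral n) (s : Vars n) : 0 ≤ disagreementSq S s :=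
  Finset.sum_nonneg fun _ _ => dotProduct_self_nonneg_real _

/-- The total contribution of the search directions to the change of the energy. -/
lemma sum_trackSum_sq_le [Nonempty (Agent n)] (hn : ∀ i, 0 < n i)
    (hlip : ∀ a x y, ‖gradient (f a) x - gradient (f a) y‖ ≤ lip a * ‖x - y‖)
    (hS : S.IsFor G R C) (huv : ∀ i, 0 < S.u i ⬝ᵥ S.v i)
    (h2 : 0 < γ₂ G C lip l S) (h3 : 0 < γ₃ G C lip l S)
    {s : Vars n} (hs : IsTracking f s) {y : EuclideanSpace ℝ (Fin N)}
    (hy : ∀ i, ∑ j : Fin (n i), agentSlope f ⟨i, j⟩ (spread n y) = 0) :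
    (∑ i, vecNorm (S.u i) ^ 2 / ((n i : ℝ) * (S.u i ⬝ᵥ S.v i)) *
        (trackSum s i ⬝ᵥ trackSum s i)) +
      γ₂ G C lip l S * (∑ i, nSum n * κM G S *
        specNorm ((1 / (n i : ℝ)) • leftProj (S.u i)) ^ 2 * (trackSum s i ⬝ᵥ trackSum s i)) +
      γ₃ G C lip l S * (∑ i, 1 / (n i : ℝ) ^ 2 *
        (2 * specNorm ((R i - leftProj (S.u i))ᵀ * S.WR i * (1 - leftProj (S.u i))) ^ 2
          + specNorm ((1 - leftProj (S.u i))ᵀ * S.WR i * (1 - leftProj (S.u i)))) *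
        (trackSum s i ⬝ᵥ trackSum s i)) ≤
      sigma G R C lip l S *
        (N * ‖avgState S s.x - y‖ ^ 2 + trackErrSq S s + estErr S s ⬝ᵥ estErr S s) := by
  set E := ‖avgState S s.x - y‖ ^ 2 with hE
  set T : Fin N → ℝ := fun i =>
    (1 / n i : ℝ) * (trackErr S s i ⬝ᵥ trackErr S s i) + estErrSq S s i + E with hT
  have hT0 : ∀ i, 0 ≤ T i := fun i =>
    add_nonneg (add_nonneg (mul_nonneg (by positivity) (dotProduct_self_nonneg_real _))
      (estErrSq_nonneg S s i)) (sq_nonneg _)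
  have hΦ : ∀ i, trackSum s i ⬝ᵥ trackSum s i ≤ b₀ lip S i * T i := fun i =>
    trackSum_sq_le hn hlip hs hy i
  have hκ := (κM_pos hS).le
  have hsumT : ∑ i, T i = N * E + trackErrSq S s + estErr S s ⬝ᵥ estErr S s := by
    simp only [hT, Finset.sum_add_distrib, estErr_dotProduct_self, trackErrSq, Finset.sum_const,
      Finset.card_univ, Fintype.card_fin, nsmul_eq_mul]
    ring
  rw [← hsumT, Finset.mul_sum, Finset.mul_sum, Finset.mul_sum, ← Finset.sum_add_distrib,
    ← Finset.sum_add_distrib]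
  refine Finset.sum_le_sum fun i _ => ?_
  have hn0 : (0 : ℝ) < n i := by exact_mod_cast hn i
  have huvi := huv i
  have hw : ∀ {w b B : ℝ}, 0 ≤ w → w * b₀ lip S i = b → b ≤ B →
      w * (trackSum s i ⬝ᵥ trackSum s i) ≤ B * T i := by
    intro w b B hw hb hB
    calc w * (trackSum s i ⬝ᵥ trackSum s i) ≤ w * (b₀ lip S i * T i) :=
          mul_le_mul_of_nonneg_left (hΦ i) hw
      _ = b * T i := by rw [← hb]; ring
      _ ≤ B * T i := mul_le_mul_of_nonneg_right hB (hT0 i)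
  have e1 := hw (by positivity) rfl (le_iSup_of_finite (b₁ lip S) i)
  have e2 := hw (mul_nonneg (mul_nonneg (Nat.cast_nonneg (nSum n)) hκ) (sq_nonneg
    (specNorm ((1 / (n i : ℝ)) • leftProj (S.u i))))) rfl (le_iSup_of_finite (b₂ G lip S) i)
  have e3 := hw (mul_nonneg (by positivity) (add_nonneg (mul_nonneg two_pos.le (sq_nonneg _))
    (specNorm_nonneg _))) rfl (le_iSup_of_finite (b₃ R lip S) i)
  have e2' := mul_le_mul_of_nonneg_left e2 h2.le
  have e3' := mul_le_mul_of_nonneg_left e3 h3.le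
  refine (add_le_add (add_le_add e1 e2') e3').trans (le_of_eq ?_)
  rw [sigma]
  ring

lemma avgEnergy_le (y : EuclideanSpace ℝ (Fin N)) (s : Vars n) :
    avgEnergy S α y s ≤ (⨆ i : Fin N, (n i : ℝ) ^ 3 / (α * (S.u i ⬝ᵥ S.v i))) *
      ‖avgState S s.x - y‖ ^ 2 := by
  rw [EuclideanSpace.real_norm_sq_eq, Finset.mul_sum]
  exact Finset.sum_le_sum fun i _ => mul_le_mul_of_nonneg_right
    (le_iSup_of_finite (fun i : Fin N => (n i : ℝ) ^ 3 / (α * (S.u i ⬝ᵥ S.v i))) i) (sq_nonneg _)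

lemma trackEnergy_le (s : Vars n) :
    trackEnergy S s ≤ (⨆ i, specNorm (S.Wc i)) * trackErrSq S s := by
  rw [trackErrSq, Finset.mul_sum]
  refine Finset.sum_le_sum fun i _ => ?_
  rw [mul_left_comm]
  exact mul_le_mul_of_nonneg_left ((dotProduct_mulVec_self_le _ _).trans
    (mul_le_mul_of_nonneg_right (le_iSup_of_finite (fun i => specNorm (S.Wc i)) i)
      (dotProduct_self_nonneg_real _))) (by positivity)

lemma disagreementEnergy_le (s : Vars n) :
    disagreementEnergy S s ≤ (⨆ i, specNorm (S.WR i)) * disagreementSq S s := by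
  rw [disagreementSq, Finset.mul_sum]
  exact Finset.sum_le_sum fun i _ => (dotProduct_mulVec_self_le _ _).trans
    (mul_le_mul_of_nonneg_right (le_iSup_of_finite (fun i => specNorm (S.WR i)) i)
      (dotProduct_self_nonneg_real _))

lemma disagreementSq_le (hS : S.IsFor G R C) (s : Vars n) :
    disagreementSq S s ≤ disagreementEnergy S s :=
  Finset.sum_le_sum fun i _ => (hS.WR_lyap i).dotProduct_self_le _

lemma trackEnergy_nonneg (hS : S.IsFor G R C) (s : Vars n) : 0 ≤ trackEnergy S s :=
  Finset.sum_nonneg fun i _ => mul_nonneg (by positivity)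
    ((dotProduct_self_nonneg_real _).trans ((hS.Wc_lyap i).dotProduct_self_le _))

lemma estEnergy_nonneg (hS : S.IsFor G R C) (s : Vars n) : 0 ≤ estEnergy S s :=
  (dotProduct_self_nonneg_real _).trans (hS.WM_lyap.dotProduct_self_le _)

lemma avgEnergy_nonneg (huv : ∀ i, 0 < S.u i ⬝ᵥ S.v i) (hα : 0 < α)
    (y : EuclideanSpace ℝ (Fin N)) (s : Vars n) : 0 ≤ avgEnergy S α y s :=
  Finset.sum_nonneg fun i _ => by have := huv i; positivity

lemma mul_le_mul_of_le_div {ε c a M e : ℝ} (hM : 0 < M) (he : 0 ≤ e) (hε : 0 ≤ ε)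
    (h : ε ≤ c / M) (ha : a ≤ M * e) : ε * a ≤ c * e := by
  calc ε * a ≤ ε * (M * e) := mul_le_mul_of_nonneg_left ha hε
    _ = ε * M * e := by ring
    _ ≤ c * e := mul_le_mul_of_nonneg_right ((le_div_iff₀ hM).1 h) he

lemma decay_mul_avgEnergy_le [Nonempty (Fin N)] (hn : ∀ i, 0 < n i)
    (huv : ∀ i, 0 < S.u i ⬝ᵥ S.v i) (hα : 0 < α) (hε : 0 ≤ decay l S α)
    (y : EuclideanSpace ℝ (Fin N)) (s : Vars n) :
    decay l S α * avgEnergy S α y s ≤ l / 2 * ‖avgState S s.x - y‖ ^ 2 := by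
  obtain ⟨i⟩ := ‹Nonempty (Fin N)›
  have hn0 : (0 : ℝ) < n i := by exact_mod_cast hn i
  have huvi := huv i
  refine mul_le_mul_of_le_div (iSup_pos_of_pos (i := i) (by positivity)) (sq_nonneg _) hε ?_
    (avgEnergy_le y s)
  rw [div_div]
  exact (min_le_left _ _).trans (min_le_left _ _)

lemma decay_mul_trackEnergy_le [Nonempty (Fin N)] (hn : ∀ i, 0 < n i) (hS : S.IsFor G R C)
    (hε : 0 ≤ decay l S α) (s : Vars n) :
    decay l S α * trackEnergy S s ≤ 1 / 8 * trackErrSq S s := by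
  obtain ⟨i⟩ := ‹Nonempty (Fin N)›
  have hne : Nonempty (Fin (n i)) := ⟨⟨0, hn i⟩⟩
  refine mul_le_mul_of_le_div (iSup_pos_of_pos (i := i)
    (one_pos.trans_le (hS.Wc_lyap i).one_le_specNorm)) (trackErrSq_nonneg S s) hε ?_
    (trackEnergy_le s)
  rw [div_div]
  exact (min_le_left _ _).trans (min_le_right _ _)

lemma decay_mul_estEnergy_le [Nonempty (Agent n)] (hS : S.IsFor G R C)
    (hε : 0 ≤ decay l S α) (s : Vars n) :
    decay l S α * estEnergy S s ≤ 1 / 8 * (estErr S s ⬝ᵥ estErr S s) := by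
  refine mul_le_mul_of_le_div (one_pos.trans_le hS.WM_lyap.one_le_specNorm)
    (dotProduct_self_nonneg_real _) hε ?_ (dotProduct_mulVec_self_le _ _)
  rw [div_div]
  exact (min_le_right _ _).trans (min_le_left _ _)

lemma decay_mul_disagreementEnergy_le [Nonempty (Fin N)] (hn : ∀ i, 0 < n i)
    (hS : S.IsFor G R C) (hε : 0 ≤ decay l S α) (s : Vars n) :
    decay l S α * disagreementEnergy S s ≤ 1 / 4 * disagreementSq S s := by
  obtain ⟨i⟩ := ‹Nonempty (Fin N)›
  have hne : Nonempty (Fin (n i)) := ⟨⟨0, hn i⟩⟩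
  refine mul_le_mul_of_le_div (iSup_pos_of_pos (i := i)
    (one_pos.trans_le (hS.WR_lyap i).one_le_specNorm)) (disagreementSq_nonneg S s) hε ?_
    (disagreementEnergy_le s)
  rw [div_div]
  exact (min_le_right _ _).trans (min_le_right _ _)

/-- With the weights `γ₁, γ₂, γ₃`, the cross terms use up half of the negative term of each of the
three error energies. The bound on `α` lets the search directions use up at most half of what is
left, and half of the negative term of `avgEnergy`. The remainder is at least the fraction
`decay l S α` of the energy. -/
lemma energy_nextVars_le [Nonempty (Fin N)] [Nonempty (Agent n)] (hn : ∀ i, 0 < n i)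
    (hC2 : ∀ a, ContDiff ℝ 2 (f a))
    (hlip : ∀ a x y, ‖gradient (f a) x - gradient (f a) y‖ ≤ lip a * ‖x - y‖) (hl : 0 < l)
    (hmono : ∀ a b : EuclideanSpace ℝ (Fin N),
      l * ‖a - b‖ ^ 2 ≤ inner ℝ (a - b) (pseudoGradient f a - pseudoGradient f b))
    (hR : IsRowWeights G R) (hC : IsColWeights G C) (hS : S.IsFor G R C)
    (huv : ∀ i, 0 < S.u i ⬝ᵥ S.v i)
    (h1 : 0 < γ₁ l S) (h2 : 0 < γ₂ G C lip l S) (h3 : 0 < γ₃ G C lip l S)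
    (hσ : 0 < sigma G R C lip l S) (hα : 0 < α) (hαle : α ≤ stepBound G R C lip l S)
    {s : Vars n} (hs : IsTracking f s) {y : EuclideanSpace ℝ (Fin N)}
    (hy : pseudoGradient f y = 0) :
    energy G C lip l S α y (nextVars G R C f α s) ≤
      (1 - decay l S α) * energy G C lip l S α y s := by
  have hN : (0 : ℝ) < N := by
    obtain ⟨i⟩ := ‹Nonempty (Fin N)›
    exact_mod_cast i.pos
  have hy' : ∀ i, ∑ j : Fin (n i), agentSlope f ⟨i, j⟩ (spread n y) = 0 := fun i => by
    rw [← pseudoGradient_apply hC2, hy]; rfl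
  have s1 : α * (sigma G R C lip l S * N) ≤ l / 2 := by
    have h := hαle.trans ((min_le_left _ _).trans (min_le_left _ _))
    rw [le_div_iff₀ (by positivity)] at h
    linarith
  have s2 : α * sigma G R C lip l S ≤ γ₁ l S / 8 := by
    have h := hαle.trans ((min_le_left _ _).trans (min_le_right _ _))
    rw [le_div_iff₀ (by positivity)] at h
    linarith
  have s3 : α * sigma G R C lip l S ≤ γ₂ G C lip l S / 8 := by
    have h := hαle.trans ((min_le_right _ _).trans (min_le_left _ _))
    rw [le_div_iff₀ (by positivity)] at h
    linarith
  have s4 : α ≤ 1 := hαle.trans ((min_le_right _ _).trans (min_le_right _ _))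
  have e1 := avgEnergy_nextVars_le hn hC2 hlip hl hmono hS huv hα hs hy
  have e2 := mul_le_mul_of_nonneg_left
    (trackEnergy_nextVars_le (α := α) hn hlip hS hC s) h1.le
  have e3 := mul_le_mul_of_nonneg_left (estEnergy_nextVars_le (f := f) hS hα s4 s) h2.le
  have e4 := mul_le_mul_of_nonneg_left
    (disagreementEnergy_nextVars_le (f := f) hn hS hR hα s4 s) h3.le
  have e5 := mul_le_mul_of_nonneg_left
    (sum_trackSum_sq_le hn hlip hS huv h2 h3 hs hy') hα.le
  have hε : 0 ≤ decay l S α := (decay_pos hn hl hS huv hα).le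
  have d1 := decay_mul_avgEnergy_le hn huv hα hε y s
  have d2 := mul_le_mul_of_nonneg_left (decay_mul_trackEnergy_le hn hS hε s) h1.le
  have d3 := mul_le_mul_of_nonneg_left (decay_mul_estEnergy_le hS hε s) h2.le
  have d4 := mul_le_mul_of_nonneg_left (decay_mul_disagreementEnergy_le hn hS hε s) h3.le
  have hE : 0 ≤ ‖avgState S s.x - y‖ ^ 2 := sq_nonneg _
  have hH := trackErrSq_nonneg S s
  have hZ := dotProduct_self_nonneg_real (estErr S s)
  have t1 := mul_le_mul_of_nonneg_right s1 hE
  have t2 := mul_le_mul_of_nonneg_right s2 hH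
  have t3 := mul_le_mul_of_nonneg_right s3 hZ
  have g1 : βxψ l S = γ₁ l S / 4 := by rw [γ₁]; ring
  have g2 : βxξ (n := n) lip l = γ₂ G C lip l S / 4 - βψξ G C lip S * γ₁ l S := by
    rw [γ₂]; ring
  have g3 : γ₃ G C lip l S / 4 = βψx G C lip S * γ₁ l S + βξx G S * γ₂ G C lip l S := by
    rw [γ₃]; ring
  have g3X : γ₃ G C lip l S / 4 * disagreementSq S s =
    (βψx G C lip S * γ₁ l S + βξx G S * γ₂ G C lip l S) * disagreementSq S s := by rw [g3]
  rw [g1, g2] at e1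
  rw [energy, energy]
  linarith

lemma norm_sub_sq_le_energy (hn : ∀ i, 0 < n i) (hS : S.IsFor G R C)
    (huv : ∀ i, 0 < S.u i ⬝ᵥ S.v i) (h1 : 0 < γ₁ l S) (h2 : 0 < γ₂ G C lip l S)
    (h3 : 0 < γ₃ G C lip l S) (hα : 0 < α) (y : EuclideanSpace ℝ (Fin N)) (s : Vars n) :
    ‖s.x - spread n y‖ ^ 2 ≤ (2 / γ₃ G C lip l S + 2 * ((⨆ p : Fin N, (n p : ℝ)) *
      ⨆ i : Fin N, α * (S.u i ⬝ᵥ S.v i) / (n i : ℝ) ^ 3)) * energy G C lip l S α y s := by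
  have hE : ‖avgState S s.x - y‖ ^ 2 ≤ (⨆ i : Fin N, α * (S.u i ⬝ᵥ S.v i) / (n i : ℝ) ^ 3) *
      avgEnergy S α y s := by
    rw [EuclideanSpace.real_norm_sq_eq, avgEnergy, Finset.mul_sum]
    refine Finset.sum_le_sum fun i _ => ?_
    have hn0 : (0 : ℝ) < n i := by exact_mod_cast hn i
    have huvi := huv i
    calc (avgState S s.x - y) i ^ 2 = α * (S.u i ⬝ᵥ S.v i) / (n i : ℝ) ^ 3 *
          ((n i : ℝ) ^ 3 / (α * (S.u i ⬝ᵥ S.v i)) * (avgState S s.x i - y i) ^ 2) := by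
            rw [PiLp.sub_apply]; field_simp
      _ ≤ _ := mul_le_mul_of_nonneg_right (le_iSup_of_finite
          (fun i : Fin N => α * (S.u i ⬝ᵥ S.v i) / (n i : ℝ) ^ 3) i) (by positivity)
  have hx : ‖s.x - spread n (avgState S s.x)‖ ^ 2 = disagreementSq S s := by
    rw [EuclideanSpace.real_norm_sq_eq, Fintype.sum_sigma, disagreementSq]
    simp only [dotProduct, ← sq, disagreement_apply]
    rfl
  have hsplit : ‖s.x - spread n y‖ ^ 2 ≤
      2 * disagreementSq S s + 2 * ‖spread n (avgState S s.x - y)‖ ^ 2 := by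
    have e : s.x - spread n y = (s.x - spread n (avgState S s.x)) +
        spread n (avgState S s.x - y) := by
      rw [← spreadCLM_apply (_ - _), map_sub, spreadCLM_apply, spreadCLM_apply]
      abel
    rw [e, ← hx]
    have h := norm_add_le (s.x - spread n (avgState S s.x)) (spread n (avgState S s.x - y))
    have h' := pow_le_pow_left₀ (norm_nonneg _) h 2
    nlinarith [sq_nonneg (‖s.x - spread n (avgState S s.x)‖ - ‖spread n (avgState S s.x - y)‖)]
  have hA := avgEnergy_nonneg huv hα y s
  have hT := mul_nonneg h1.le (trackEnergy_nonneg hS s)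
  have hZ := mul_nonneg h2.le (estEnergy_nonneg hS s)
  have hX := disagreementSq_le hS s
  have hX0 := mul_nonneg h3.le ((disagreementSq_nonneg S s).trans hX)
  have hsup : (0 : ℝ) ≤ ⨆ p : Fin N, (n p : ℝ) := Real.iSup_nonneg fun p => Nat.cast_nonneg _
  have hsup' : 0 ≤ ⨆ i : Fin N, α * (S.u i ⬝ᵥ S.v i) / (n i : ℝ) ^ 3 :=
    Real.iSup_nonneg fun i => by have := huv i; positivity
  have k1 : 2 * disagreementSq S s ≤ 2 / γ₃ G C lip l S * energy G C lip l S α y s := by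
    rw [div_mul_eq_mul_div, le_div_iff₀ h3, energy]
    nlinarith
  have k2 : 2 * ‖spread n (avgState S s.x - y)‖ ^ 2 ≤ 2 * ((⨆ p : Fin N, (n p : ℝ)) *
      ⨆ i : Fin N, α * (S.u i ⬝ᵥ S.v i) / (n i : ℝ) ^ 3) * energy G C lip l S α y s := by
    have hle : avgEnergy S α y s ≤ energy G C lip l S α y s := by rw [energy]; linarith
    have h := (norm_spread_sq_le (n := n) (avgState S s.x - y)).trans
      (mul_le_mul_of_nonneg_left (hE.trans (mul_le_mul_of_nonneg_left hle hsup')) hsup)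
    linarith
  rw [add_mul]
  linarith

lemma energy_run_le [Nonempty (Fin N)] [Nonempty (Agent n)] (hn : ∀ i, 0 < n i)
    (hC2 : ∀ a, ContDiff ℝ 2 (f a))
    (hlip : ∀ a x y, ‖gradient (f a) x - gradient (f a) y‖ ≤ lip a * ‖x - y‖) (hl : 0 < l)
    (hmono : ∀ a b : EuclideanSpace ℝ (Fin N),
      l * ‖a - b‖ ^ 2 ≤ inner ℝ (a - b) (pseudoGradient f a - pseudoGradient f b))
    (hR : IsRowWeights G R) (hC : IsColWeights G C) (hS : S.IsFor G R C)
    (huv : ∀ i, 0 < S.u i ⬝ᵥ S.v i)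
    (h1 : 0 < γ₁ l S) (h2 : 0 < γ₂ G C lip l S) (h3 : 0 < γ₃ G C lip l S)
    (hσ : 0 < sigma G R C lip l S) (hα : 0 < α) (hαle : α ≤ stepBound G R C lip l S)
    {y : EuclideanSpace ℝ (Fin N)} (hy : pseudoGradient f y = 0)
    (x₀ : State n) (ξ₀ : Agent n → State n) (k : ℕ) :
    energy G C lip l S α y (run G R C f α x₀ ξ₀ k) ≤
      (1 - decay l S α) ^ k * energy G C lip l S α y (run G R C f α x₀ ξ₀ 0) := by
  induction k with
  | zero => simp
  | succ k ih =>
    have h := energy_nextVars_le hn hC2 hlip hl hmono hR hC hS huv h1 h2 h3 hσ hα hαle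
      (isTracking_run (R := R) (α := α) hC x₀ ξ₀ k) hy
    have hd : 0 ≤ 1 - decay l S α := by linarith [decay_lt_one (l := l) (α := α) hS]
    refine h.trans ((mul_le_mul_of_nonneg_left ih hd).trans (le_of_eq ?_))
    rw [pow_succ]
    ring

lemma le_sqrt_mul_sqrt_pow {d K q : ℝ} (hq : 0 ≤ q) (k : ℕ)
    (h : d ^ 2 ≤ K * q ^ k) : d ≤ √K * √q ^ k := by
  refine Real.le_sqrt_of_sq_le h |>.trans (le_of_eq ?_)
  rw [Real.sqrt_mul' _ (pow_nonneg hq k)]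
  congr 1
  rw [Real.sqrt_eq_iff_eq_sq (pow_nonneg hq k) (by positivity), ← pow_mul, mul_comm, pow_mul,
    Real.sq_sqrt hq]

end Convergence

end CoalitionGame

/-! ### Convergence of the algorithm -/

open CoalitionGame in
theorem theorem1 {N : ℕ} (n : Fin N → ℕ) (hn : ∀ i, 0 < n i)
    (hcard : 2 ≤ CoalitionGame.nSum n)
    (G : Digraph (CoalitionGame.Agent n))
    (hG : CoalitionGame.StronglyConnected G)
    (hGi : ∀ i, CoalitionGame.StronglyConnected (CoalitionGame.coalitionGraph G i))
    (f : CoalitionGame.Agent n → CoalitionGame.State n → ℝ)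
    (hconv : ∀ a, ConvexOn ℝ Set.univ (f a))
    (hC2 : ∀ a, ContDiff ℝ 2 (f a))
    (lip : CoalitionGame.Agent n → ℝ)
    (hlip : ∀ a x y, ‖gradient (f a) x - gradient (f a) y‖ ≤ lip a * ‖x - y‖)
    (l : ℝ) (hl : 0 < l)
    (hmono : ∀ a b : EuclideanSpace ℝ (Fin N),
      l * ‖a - b‖ ^ 2 ≤
        inner ℝ (a - b) (CoalitionGame.pseudoGradient f a - CoalitionGame.pseudoGradient f b))
    (R C : ∀ i, Matrix (Fin (n i)) (Fin (n i)) ℝ)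
    (hR : CoalitionGame.IsRowWeights G R) (hC : CoalitionGame.IsColWeights G C) :
    (∃! xs : CoalitionGame.State n, CoalitionGame.IsNashEquilibrium f xs) ∧
    (∃ S : CoalitionGame.Spectral n, S.IsFor G R C) ∧
    ∀ S : CoalitionGame.Spectral n, S.IsFor G R C →
      0 < CoalitionGame.stepBound G R C lip l S ∧
      ∀ α : ℝ, 0 < α → α ≤ CoalitionGame.stepBound G R C lip l S →
        (0 < CoalitionGame.decay l S α ∧ CoalitionGame.decay l S α < 1) ∧
        ∀ xs : CoalitionGame.State n, CoalitionGame.IsNashEquilibrium f xs →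
        ∀ (x₀ : CoalitionGame.State n) (ξ₀ : CoalitionGame.Agent n → CoalitionGame.State n),
          Tendsto (fun k => (CoalitionGame.run G R C f α x₀ ξ₀ k).x) atTop (𝓝 xs) ∧
          ∃ K : ℝ, ∀ k : ℕ,
            ‖(CoalitionGame.run G R C f α x₀ ξ₀ k).x - xs‖ ≤
              K * √(1 - CoalitionGame.decay l S α) ^ k := by
  have : Nonempty (Fin N) := nonempty_fin_of_nSum hcard
  have : Nonempty (Agent n) := by
    obtain ⟨i⟩ := ‹Nonempty (Fin N)›
    exact ⟨⟨i, ⟨0, hn i⟩⟩⟩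
  refine ⟨existsUnique_isNashEquilibrium hconv hC2 hlip hl hmono,
    exists_spectral hn hcard hG hGi hR hC, fun S hS => ?_⟩
  have hu : ∀ i j, 0 < S.u i j := fun i => hS.u_pos hR (hn i) (hGi i)
  have huv : ∀ i, 0 < S.u i ⬝ᵥ S.v i := fun i => hS.dotProduct_pos hR hC (hn i) (hGi i)
  have hβ1 := βxψ_pos hn hl hu huv
  have hβ2 := βxξ_pos hC2 hlip hl hmono hn
  have h1 := γ₁_pos hβ1
  have h2 : 0 < γ₂ G C lip l S := γ₂_pos hβ1 hβ2
  have h3 : 0 < γ₃ G C lip l S := γ₃_pos hcard hS hβ1 hβ2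
  have hσ := sigma_pos hn hS hu huv h2 h3
  refine ⟨stepBound_pos hl h1 h2 hσ, fun α hα hαle => ?_⟩
  have hd0 := decay_pos hn hl hS huv hα
  have hd1 : decay l S α < 1 := decay_lt_one hS
  refine ⟨⟨hd0, hd1⟩, fun xs hxs x₀ ξ₀ => ?_⟩
  obtain ⟨y, rfl, hy⟩ := (isNashEquilibrium_iff hconv hC2 xs).1 hxs
  obtain ⟨K, hK⟩ : ∃ K : ℝ, ∀ k : ℕ, ‖(run G R C f α x₀ ξ₀ k).x - spread n y‖ ≤
      K * √(1 - decay l S α) ^ k := by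
    set M := 2 / γ₃ G C lip l S + 2 * ((⨆ p : Fin N, (n p : ℝ)) *
      ⨆ i : Fin N, α * (S.u i ⬝ᵥ S.v i) / (n i : ℝ) ^ 3)
    have hM : 0 ≤ M := by
      refine add_nonneg (by positivity) (mul_nonneg two_pos.le (mul_nonneg
        (Real.iSup_nonneg fun p => Nat.cast_nonneg _) (Real.iSup_nonneg fun i => ?_)))
      have := huv i
      positivity
    refine ⟨√(M * energy G C lip l S α y (run G R C f α x₀ ξ₀ 0)), fun k => ?_⟩
    refine le_sqrt_mul_sqrt_pow (by linarith) k ?_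
    refine (norm_sub_sq_le_energy hn hS huv h1 h2 h3 hα y _).trans ?_
    refine (mul_le_mul_of_nonneg_left (energy_run_le hn hC2 hlip hl hmono hR hC hS huv h1 h2 h3
      hσ hα hαle hy x₀ ξ₀ k) hM).trans (le_of_eq ?_)
    ring
  refine ⟨?_, K, hK⟩
  have hq : √(1 - decay l S α) < 1 := by
    rw [Real.sqrt_lt' one_pos]
    linarith
  have ht := (tendsto_pow_atTop_nhds_zero_of_lt_one (Real.sqrt_nonneg _) hq).const_mul K
  rw [mul_zero] at ht
  exact tendsto_iff_norm_sub_tendsto_zero.2 (squeeze_zero (fun _ => norm_nonneg _) hK ht)
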